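/- There is an absolute constant $C$ such that the following holds. Let $G$ be an $m\times n$ grid graph, i.e. the graph with vertex set $\{1,\dots,m\}\times\{1,\dots,n\}$ in which $(i,j)$ and $(i',j')$ are adjacent iff $|i-i'|+|j-j'|=1$, and let $X$ be a nonempty set of its vertices (the exits). Then there is a deterministic distributed algorithm (depending on $G$ and $X$ only) such that for every nonempty set $H$ of vertices with $H\cap X=\emptyset$ (the homebases), when one agent is placed at each vertex of $H$ and every agent executes the algorithm, the resulting movement of the agents is an evacuation strategy of length at most $C\cdot OPT(G,X,H)$. Here, an evacuation strategy assigns to each agent a route starting at its homebase such that in each step the agent stays still or moves to a neighbouring vertex; an agent is removed (evacuates) at the end of the first step at which it is located at an exit; all agents evacuate; and no two agents that have not evacuated before step $t$ are located at the same vertex at the end of step $t$ (two agents may swap their positions). Its length is the number of steps until the last agent evacuates, and $OPT(G,X,H)$ is the minimum length of an evacuation strategy, where the strategy may be chosen with full knowledge of $H$. The distributed model is synchronous: each agent knows $G$, $X$ and its own homebase (which serves as its identifier) and has finite but arbitrarily large memory, but knows neither $H$ nor $|H|$; at the beginning of each step, agents that are located at adjacent vertices or at vertices with a common neighbour exchange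 an arbitrary finite number of messages, and then each agent chooses its move as a function of its location and memory. -/

import Mathlib

/-- The `m × n` grid: the Cartesian product of a path on `m` vertices and a path on `n` vertices. -/
def gridGraph (m n : ℕ) : SimpleGraph (Fin m × Fin n) :=
  (SimpleGraph.pathGraph m).boxProd (SimpleGraph.pathGraph n)

/-- Two vertices of the grid are adjacent iff `|i - i'| + |j - j'| = 1`. -/
theorem gridGraph_adj {m n : ℕ} (u v : Fin m × Fin n) :
    (gridGraph m n).Adj u v ↔
      |(u.1.val : ℤ) - (v.1.val : ℤ)| + |(u.2.val : ℤ) - (v.2.val : ℤ)| = 1 := by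
  obtain ⟨⟨a, ha⟩, ⟨b, hb⟩⟩ := u
  obtain ⟨⟨c, hc⟩, ⟨d, hd⟩⟩ := v
  simp only [gridGraph, SimpleGraph.boxProd_adj, SimpleGraph.pathGraph_adj, Fin.mk.injEq]
  rcases abs_cases ((a : ℤ) - (c : ℤ)) with h | h <;>
    rcases abs_cases ((b : ℤ) - (d : ℤ)) with h' | h' <;> omega

namespace Evacuation

/-! ### Evacuation strategies and the offline optimum

Agents are named by their homebases, so the set of agents is the subtype `H` and `a : H` starts
at the vertex `a`. -/

/-- The positioning functions `loc` (`loc a t` is the vertex occupied by agent `a` at the end of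
step `t`) form an evacuation strategy in which agent `a` evacuates at the end of step `s a`.
Vertices only have to be pairwise distinct after simultaneous moves; in particular two agents may
swap. Values of `loc a` after step `s a` are irrelevant. -/
structure IsStrategyWithTimes {V : Type} (G : SimpleGraph V) (X H : Finset V)
    (loc : H → ℕ → V) (s : H → ℕ) : Prop where
  /-- every agent starts at its homebase -/
  start : ∀ a : H, loc a 0 = a
  /-- in each step an agent stays still or moves to a neighbour -/
  move : ∀ a : H, ∀ t < s a, loc a (t + 1) = loc a t ∨ G.Adj (loc a t) (loc a (t + 1))
  /-- at the end of step `s a` the agent is located at an exit ... -/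
  exit : ∀ a : H, loc a (s a) ∈ X
  /-- ... for the first time -/
  first : ∀ a : H, ∀ t < s a, loc a t ∉ X
  /-- no two agents present in the graph occupy the same vertex -/
  collision_free : ∀ a b : H, a ≠ b → ∀ t, 1 ≤ t → t ≤ min (s a) (s b) → loc a t ≠ loc b t

/-- `loc` is an evacuation strategy of length `ℓ`, the number of steps until the last agent
evacuates. -/
def IsStrategyOfLength {V : Type} (G : SimpleGraph V) (X H : Finset V)
    (loc : H → ℕ → V) (ℓ : ℕ) : Prop :=
  ∃ s : H → ℕ, IsStrategyWithTimes G X H loc s ∧ Finset.univ.sup s = ℓ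

/-- The minimum length of an evacuation strategy (computed with full knowledge of `H`). -/
noncomputable def OPT {V : Type} (G : SimpleGraph V) (X H : Finset V) : ℕ :=
  sInf {ℓ : ℕ | ∃ loc : H → ℕ → V, IsStrategyOfLength G X H loc ℓ}

/-! ### Distributed algorithms -/

/-- A deterministic distributed algorithm, executed by each agent independently, on a graph with
vertex set `V`. The vertices serve as identifiers of nodes, and the homebase of an agent serves as
its identifier. In each step the agents present carry out `rounds` synchronous rounds of message
exchange (messages may be arbitrarily large), and then each of them decides on its action. -/
structure DistributedAlgorithm (V : Type) where
  /-- possible contents of an agent's memory, which is finite but arbitrarily large -/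
  Mem : Type
  finite_mem : Finite Mem
  /-- messages -/
  Msg : Type
  /-- the number of rounds of message exchange in a step -/
  rounds : ℕ
  /-- the initial memory of an agent, which only depends on its homebase -/
  init : V → Mem
  /-- the message sent by an agent to all agents in range, given its location and memory -/
  send : V → Mem → Msg
  /-- the new memory of an agent, given its location, its memory, and the messages received in
  the round: for each identifier, the message of the agent with this identifier, or `none` if no
  such agent is present in range -/
  receive : V → Mem → (V → Option Msg) → Mem
  /-- the action of an agent, given its location and memory after the exchange of messages: its
  new memory, and the vertex it moves to (its own location if it stays still) -/
  act : V → Mem → Mem × V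

/-- Agents located at `u` and `v` can communicate directly: `u` and `v` are neighbours or have a
common neighbour. -/
def InRange {V : Type} (G : SimpleGraph V) (u v : V) : Prop :=
  G.Adj u v ∨ ∃ w, G.Adj u w ∧ G.Adj w v

namespace DistributedAlgorithm

variable {V : Type} (A : DistributedAlgorithm V)

/-- The location and the memory of an agent. An agent whose location is an exit has evacuated
(homebases are not exits). -/
structure AgentState where
  loc : V
  mem : A.Mem

/-- The messages received by agent `a` in a round of communication, by identifier of the sender.
Only agents that are still present send messages. -/
noncomputable def inbox (G : SimpleGraph V) (X H : Finset V) (σ : H → A.AgentState) (a : H) :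
    V → Option A.Msg := by
  classical
  exact fun v =>
    if hv : v ∈ H then
      let b : H := ⟨v, hv⟩
      if b ≠ a ∧ (σ b).loc ∉ X ∧ InRange G (σ a).loc (σ b).loc then
        some (A.send (σ b).loc (σ b).mem)
      else none
    else none

/-- One synchronous round of message exchange. -/
noncomputable def round (G : SimpleGraph V) (X H : Finset V) (σ : H → A.AgentState) :
    H → A.AgentState :=
  fun a => ⟨(σ a).loc, A.receive (σ a).loc (σ a).mem (A.inbox G X H σ a)⟩

/-- One step: the rounds of message exchange, followed by the simultaneous actions of all agents
that are still present. Evacuated agents take no part in it. -/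
noncomputable def step (G : SimpleGraph V) (X H : Finset V) (σ : H → A.AgentState) :
    H → A.AgentState := by
  classical
  exact fun a =>
    if (σ a).loc ∈ X then σ a
    else
      let τ := (A.round G X H)^[A.rounds] σ a
      ⟨(A.act τ.loc τ.mem).2, (A.act τ.loc τ.mem).1⟩

/-- The states of the agents at the end of step `t`. -/
noncomputable def state (G : SimpleGraph V) (X H : Finset V) (t : ℕ) : H → A.AgentState :=
  (A.step G X H)^[t] (fun a => ⟨a, A.init a⟩)

/-- The positioning functions produced by the algorithm when the homebases are `H`. -/
noncomputable def run (G : SimpleGraph V) (X H : Finset V) (a : H) (t : ℕ) : V :=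
  (A.state G X H t a).loc

end DistributedAlgorithm

end Evacuation

/-! The algorithm tries the guesses `L = 1, 2, 4, …` for the optimum. For each guess the grid is cut
into tiles of side at most `3 * L`, in nine shifted ways, so that every vertex lies in the central
block of its tile for one of the shifts (`exists_shift`). If `L` is at least the optimum, an agent
whose homebase is in a central block does not leave its tile in an optimal evacuation, so each tile
can be treated on its own. A stage of length `39 * L` clears the central blocks of one tiling, and
the lengths of all stages form a geometric sum.

Two things are needed inside a tile. The first is offline: agents outside the central block stand in
the way, although the optimal routes of the central agents need not be compatible with them as
obstacles. `exists_isSchedule_union` shows that such bystanders cost only a factor of 3, provided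
that agents are regarded as interchangeable: as many agents leave as there are central ones, and the
others end on the bystanders' vertices. It is proved by a fractional flow in the time-expanded
graph, in which a token reaching a well-stocked vertex immediately releases a unit already there,
and by rounding with a weighted Hall theorem.

The second is communication. Agents that see an exit in their row or column of the tile walk to it,
after which the occupied rows and columns are free of exits. Agents in a row then bounce back and
forth so that any two of them meet (`exchange_meet`); one leader per row walks to a common free
column, where the leaders do the same vertically. Running all this backwards returns the agents to
their places and spreads the leaders' knowledge (`tile_mem_know`). Everyone in the tile now computes
the same schedule.

Every stage leaves a subset of the previously occupied set occupied (`Safe`). Hence the remaining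
vertices are always homebases, the optimal routes starting there stay available, and stages with too
small a guess do no harm. -/

namespace Evacuation

/-! ### Rounding flows over time to collision-free schedules -/

/-- Weighted Hall theorem: a fractional matching (with common denominator `N`) saturating `A`
yields an injection along its support. -/
theorem exists_injOn_of_weights {α β : Type*} [DecidableEq α] [DecidableEq β] [Nonempty β]
    (A : Finset α) (B : Finset β) (x : α → β → ℕ) {N : ℕ} (hN : 0 < N)
    (hA : ∀ a ∈ A, ∑ b ∈ B, x a b = N) (hB : ∀ b ∈ B, ∑ a ∈ A, x a b ≤ N) :
    ∃ f : α → β, Set.InjOn f A ∧ ∀ a ∈ A, f a ∈ B ∧ 0 < x a (f a) := by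
  classical
  let t : A → Finset β := fun a => B.filter fun b => 0 < x a b
  have hall : ∀ s : Finset A, s.card ≤ (s.biUnion t).card := by
    intro s
    -- Double counting: `s` sends out total weight `N * s.card`, all of it into the neighbourhood,
    -- where each vertex absorbs at most `N`.
    refine Nat.le_of_mul_le_mul_left ?_ hN
    have h1 : N * s.card = ∑ a ∈ s, ∑ b ∈ s.biUnion t, x a b := by
      rw [mul_comm, ← smul_eq_mul, ← Finset.sum_const]
      refine Finset.sum_congr rfl fun a ha => ?_
      rw [← hA a a.2]
      symm
      apply Finset.sum_subset
      · intro b hb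
        simp only [Finset.mem_biUnion, t, Finset.mem_filter] at hb
        obtain ⟨_, _, hb, _⟩ := hb
        exact hb
      · intro b hb hnb
        by_contra h0
        exact hnb (Finset.mem_biUnion.mpr ⟨a, ha, Finset.mem_filter.mpr ⟨hb, Nat.pos_of_ne_zero h0⟩⟩)
    rw [h1, Finset.sum_comm, mul_comm, ← smul_eq_mul]
    refine Finset.sum_le_card_nsmul _ _ _ fun b hb => ?_
    simp only [Finset.mem_biUnion, t, Finset.mem_filter] at hb
    obtain ⟨_, _, hb, _⟩ := hb
    refine le_trans ?_ (hB b hb)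
    rw [← Finset.sum_attach A]
    exact Finset.sum_le_sum_of_subset (f := fun a : A => x a b) (fun a _ => Finset.mem_attach _ a)
  obtain ⟨f, hf, hft⟩ := (Finset.all_card_le_biUnion_card_iff_exists_injective t).mp hall
  refine ⟨fun a => if h : a ∈ A then f ⟨a, h⟩ else Classical.arbitrary β, ?_, ?_⟩
  · intro a ha b hb hab
    rw [Finset.mem_coe] at ha hb
    simp only [ha, hb, dif_pos] at hab
    exact congrArg Subtype.val (hf hab)
  · intro a ha
    have := hft ⟨a, ha⟩
    simp only [t, Finset.mem_filter] at this
    simpa only [ha, dif_pos] using this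

/-- The trajectories `r v` of agents starting at the vertices of `S`, up to time `D`: each step obeys
`M`, agents stay at exits, agents that have not evacuated before are never at the same vertex, and
in the end each agent is at an exit or in `E`. -/
structure IsSchedule {V : Type} (M : V → V → Prop) (X S E : Finset V) (D : ℕ) (r : V → ℕ → V) :
    Prop where
  start : ∀ v ∈ S, r v 0 = v
  move : ∀ v ∈ S, ∀ t < D, M (r v t) (r v (t + 1))
  absorb : ∀ v ∈ S, ∀ t < D, r v t ∈ X → r v (t + 1) = r v t
  coll : ∀ v ∈ S, ∀ w ∈ S, v ≠ w → ∀ t < D, r v t ∉ X → r w t ∉ X → r v (t + 1) ≠ r w (t + 1)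
  final : ∀ v ∈ S, r v D ∈ X ∨ r v D ∈ E

/-- Paths extracted from an injective successor function on the time-expanded graph. -/
theorem exists_isSchedule_of_injOn {V : Type} (M : V → V → Prop)
    (hM : ∀ v, M v v)
    (X H E : Finset V) {D : ℕ} (hD : 0 < D)
    (f : V × ℕ → V × ℕ)
    (hinj : ∀ v t w u, v ∉ X → t < D → w ∉ X → u < D → f (v, t) = f (w, u) → v = w ∧ t = u)
    (hstep : ∀ v t, v ∉ X → t < D → f (v, t) = (v, t) ∨ ∃ w, f (v, t) = (w, t + 1) ∧ M v w)
    (hzero : ∀ v ∈ H, f (v, 0) ≠ (v, 0))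
    (hend : ∀ v t w, v ∉ X → t < D → f (v, t) = (w, D) → w ∈ X ∨ w ∈ E) :
    ∃ r, IsSchedule M X H E D r := by
  classical
  obtain ⟨r, r0, rs⟩ : ∃ r : V → ℕ → V, (∀ v, r v 0 = v) ∧
      ∀ v t, r v (t + 1) = if r v t ∈ X ∨ D ≤ t then r v t else (f (r v t, t)).1 :=
    ⟨fun v t => Nat.rec (motive := fun _ => V) v
      (fun t u => if u ∈ X ∨ D ≤ t then u else (f (u, t)).1) t, fun _ => rfl, fun _ _ => rfl⟩
  have absorb : ∀ v t, r v t ∈ X → r v (t + 1) = r v t := by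
    intro v t h
    rw [rs, if_pos (Or.inl h)]
  have key : ∀ v ∈ H, ∀ t < D, r v t ∉ X →
      f (r v t, t) = (r v (t + 1), t + 1) ∧ M (r v t) (r v (t + 1)) := by
    intro v hv t
    induction t with
    | zero =>
      intro ht hX
      have h1 := hstep (r v 0) 0 hX ht
      rcases h1 with h1 | ⟨w, h1, h2⟩
      · exact absurd (by simpa only [r0] using h1) (hzero v hv)
      · have : r v (0 + 1) = w := by
          rw [rs, if_neg (by push Not; exact ⟨hX, ht⟩), h1]
        rw [this]; exact ⟨h1, h2⟩
    | succ t ih =>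
      intro ht hX
      have hX' : r v t ∉ X := fun h => hX (by rw [absorb v t h]; exact h)
      obtain ⟨ih1, -⟩ := ih (by omega) hX'
      rcases hstep (r v (t + 1)) (t + 1) hX ht with h1 | ⟨w, h1, h2⟩
      -- A fixed point of `f` marks an unused vertex of the time-expanded graph. A path cannot enter
      -- one, since it would have its predecessor on the path as a second preimage.
      · have := hinj _ t _ (t + 1) hX' (by omega) hX ht (by rw [ih1, h1])
        omega
      · have : r v (t + 1 + 1) = w := by
          rw [rs, if_neg (by push Not; exact ⟨hX, ht⟩), h1]
        rw [this]; exact ⟨h1, h2⟩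
  have coll1 : ∀ v ∈ H, ∀ w ∈ H, ∀ t < D, r v t ∉ X → r w t ∉ X → r v t ≠ r w t →
      r v (t + 1) ≠ r w (t + 1) := by
    intro v hv w hw t ht h1 h2 hne heq
    have hv' := (key v hv t ht h1).1
    have hw' := (key w hw t ht h2).1
    exact hne (hinj _ t _ t h1 ht h2 ht (by rw [hv', hw', heq])).1
  have coll2 : ∀ v ∈ H, ∀ w ∈ H, v ≠ w → ∀ t < D, r v t ∉ X → r w t ∉ X → r v t ≠ r w t := by
    intro v hv w hw hne t
    induction t with
    | zero => intro _ _ _; rwa [r0, r0]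
    | succ t ih =>
      intro ht h1 h2
      have h1' : r v t ∉ X := fun h => h1 (by rw [absorb v t h]; exact h)
      have h2' : r w t ∉ X := fun h => h2 (by rw [absorb w t h]; exact h)
      exact coll1 v hv w hw t (by omega) h1' h2' (ih (by omega) h1' h2')
  refine ⟨r, fun v _ => r0 v, ?_, fun v _ t _ h => absorb v t h, ?_, ?_⟩
  · intro v hv t ht
    by_cases h : r v t ∈ X
    · rw [absorb v t h]; exact hM _
    · exact (key v hv t ht h).2
  · intro v hv w hw hne t ht h1 h2
    exact coll1 v hv w hw t ht h1 h2 (coll2 v hv w hw hne t ht h1 h2)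
  · intro v hv
    obtain ⟨d, rfl⟩ : ∃ d, D = d + 1 := ⟨D - 1, by omega⟩
    by_cases h : r v d ∈ X
    · left; rw [absorb v d h]; exact h
    · exact hend _ _ _ h (by omega) (key v hv d (by omega) h).1

/-! ### Evacuating some agents in the presence of others -/

/-- The time of the `k`-th departure of a token that follows the path `q` from time `i` on. The
stop at `q (k + 1)` takes no time if `fast` holds at the previous departure. -/
def departTime {V : Type} (fast : V → ℕ → Prop) [∀ v t, Decidable (fast v t)] (q : ℕ → V) (i : ℕ) :
    ℕ → ℕ
  | 0 => i
  | k + 1 => if fast (q (k + 1)) (departTime fast q i k) then departTime fast q i k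
      else departTime fast q i k + 1

section departTime
variable {V : Type} (fast : V → ℕ → Prop) [∀ v t, Decidable (fast v t)] (q : ℕ → V)

theorem departTime_le (i k : ℕ) : departTime fast q i k ≤ i + k := by
  induction k with
  | zero => simp [departTime]
  | succ k ih => rw [departTime]; split_ifs <;> omega

/-- A later token on the same path never catches up: if it passes a vertex without delay, so does
the earlier one, because `fast` is inherited by earlier times. -/
theorem departTime_strictMono (hfast : ∀ v t t', fast v t' → t ≤ t' → fast v t) (k : ℕ) :
    StrictMono fun i => departTime fast q i k := by
  intro i j hij
  induction k with
  | zero => simpa [departTime] using hij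
  | succ k ih =>
    simp only [departTime] at ih ⊢
    by_cases h : fast (q (k + 1)) (departTime fast q j k)
    · rw [if_pos h, if_pos (hfast _ _ _ h ih.le)]; exact ih
    · rw [if_neg h]; split_ifs <;> omega

end departTime

/-- An integral flow over time with node capacities `N` that sends `N` units from each vertex of `H`
to exits or to `E` yields a schedule. -/
theorem exists_isSchedule_of_flow {V : Type} [Fintype V] [DecidableEq V] (M : V → V → Prop)
    (hM : ∀ v, M v v) (X H E : Finset V) (hHX : Disjoint H X) {D N : ℕ} (hD : 0 < D) (hN : 0 < N)
    (load : V → ℕ → ℕ) (φ : V → V → ℕ → ℕ)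
    (hφM : ∀ v w t, 0 < φ v w t → M v w)
    (hload : ∀ v t, v ∉ X → t < D → load v t ≤ N)
    (hsrc : ∀ v ∈ H, load v 0 = N)
    (hout : ∀ v t, v ∉ X → t < D → ∑ w, φ v w t = load v t)
    (hin : ∀ w t, w ∉ X → t + 1 < D → ∑ v ∈ Xᶜ, φ v w t ≤ load w (t + 1))
    (hcap : ∀ w t, t < D → ∑ v ∈ Xᶜ, φ v w t ≤ N)
    (hend : ∀ v w, v ∉ X → w ∉ X → w ∉ E → φ v w (D - 1) = 0) :
    ∃ r, IsSchedule M X H E D r := by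
  classical
  by_cases hV : Nonempty V
  swap
  · exact ⟨fun v _ => v, fun v => (hV ⟨v⟩).elim, fun v => (hV ⟨v⟩).elim, fun v => (hV ⟨v⟩).elim,
      fun v => (hV ⟨v⟩).elim, fun v => (hV ⟨v⟩).elim⟩
  let A : Finset (V × ℕ) := Xᶜ ×ˢ Finset.range D
  -- Leaving out the sources forces a path to start at each of them; leaving out the forbidden
  -- vertices at time `D` forces the paths to end in `X` or `E`.
  let B : Finset (V × ℕ) := (Finset.univ ×ˢ Finset.range (D + 1)).filter fun b =>
    (b.2 = 0 → b.1 ∉ H) ∧ (b.2 = D → b.1 ∈ X ∨ b.1 ∈ E)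
  -- Unused capacity of a vertex is matched to the vertex itself, so that the total weight leaving
  -- it is exactly `N`.
  let x : V × ℕ → V × ℕ → ℕ := fun a b =>
    (if b.2 = a.2 + 1 then φ a.1 b.1 a.2 else 0) + if b = a then N - load a.1 a.2 else 0
  have memA : ∀ a : V × ℕ, a ∈ A ↔ a.1 ∉ X ∧ a.2 < D := fun a => by simp [A]
  have memB : ∀ b : V × ℕ, b ∈ B ↔ b.2 < D + 1 ∧ (b.2 = 0 → b.1 ∉ H) ∧
      (b.2 = D → b.1 ∈ X ∨ b.1 ∈ E) := fun b => by simp [B]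
  have hA : ∀ a ∈ A, ∑ b ∈ B, x a b = N := by
    rintro ⟨v, t⟩ ha
    obtain ⟨hv, ht⟩ := (memA _).mp ha
    simp only at hv ht
    have h1 : ∑ b ∈ B, x (v, t) b = ∑ b ∈ Finset.univ ×ˢ Finset.range (D + 1), x (v, t) b := by
      apply Finset.sum_subset (Finset.filter_subset _ _)
      rintro ⟨w, u⟩ hb hnb
      simp only [Finset.mem_product, Finset.mem_univ, true_and, Finset.mem_range] at hb
      rw [memB] at hnb
      simp only [x, Prod.mk.injEq, Nat.add_eq_zero_iff, ite_eq_right_iff]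
      by_cases hu0 : u = 0
      · subst hu0
        have hw : w ∈ H := by by_contra hw; exact hnb ⟨hb, fun _ => hw, fun h => by simp at h; omega⟩
        refine ⟨fun h => by omega, ?_⟩
        rintro ⟨rfl, rfl⟩
        rw [hsrc _ hw, Nat.sub_self]
      · have hw : u = D ∧ w ∉ X ∧ w ∉ E := by
          by_contra hw
          refine hnb ⟨hb, fun h => absurd h hu0, fun h => ?_⟩
          simp only at h ⊢
          tauto
        obtain ⟨rfl, hw1, hw2⟩ := hw
        refine ⟨fun h => ?_, fun h => by omega⟩
        have := hend v w hv hw1 hw2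
        rw [h] at this
        simpa using this
    rw [h1, Finset.sum_product]
    simp only [x, Finset.sum_add_distrib]
    have h2 : ∑ w, ∑ u ∈ Finset.range (D + 1), (if u = t + 1 then φ v w t else 0) = load v t := by
      rw [← hout v t hv ht]
      refine Finset.sum_congr rfl fun w _ => ?_
      rw [Finset.sum_ite_eq' (Finset.range (D + 1)) (t + 1) (fun _ => φ v w t), if_pos (by simp; omega)]
    have h3 : ∑ w, ∑ u ∈ Finset.range (D + 1), (if (w, u) = (v, t) then N - load v t else 0) =
        N - load v t := by
      rw [← Finset.sum_product' (f := fun w u => if (w, u) = (v, t) then N - load v t else 0)]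
      rw [Finset.sum_ite_eq' _ (v, t) (fun _ => N - load v t), if_pos (by simp; omega)]
    rw [h2, h3]
    have := hload v t hv ht
    omega
  have hB : ∀ b ∈ B, ∑ a ∈ A, x a b ≤ N := by
    rintro ⟨w, u⟩ hb
    obtain ⟨hu, hu0, huD⟩ := (memB _).mp hb
    simp only at hu hu0 huD
    simp only [x, Finset.sum_add_distrib]
    have h3 : ∑ a ∈ A, (if (w, u) = a then N - load a.1 a.2 else 0) =
        if w ∉ X ∧ u < D then N - load w u else 0 := by
      rw [Finset.sum_ite_eq A (w, u) (fun a => N - load a.1 a.2)]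
      simp only [memA]
    rw [h3]
    rcases Nat.eq_zero_or_pos u with rfl | hpos
    · have : ∑ a ∈ A, (if 0 = a.2 + 1 then φ a.1 w a.2 else 0) = 0 := by
        refine Finset.sum_eq_zero fun a _ => ?_
        rw [if_neg (by omega)]
      rw [this]
      split_ifs <;> omega
    · obtain ⟨t, rfl⟩ : ∃ t, u = t + 1 := ⟨u - 1, by omega⟩
      have h4 : ∑ a ∈ A, (if t + 1 = a.2 + 1 then φ a.1 w a.2 else 0) = ∑ v ∈ Xᶜ, φ v w t := by
        rw [Finset.sum_product]
        refine Finset.sum_congr rfl fun v _ => ?_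
        simp only [Nat.add_right_cancel_iff]
        rw [Finset.sum_ite_eq (Finset.range D) t (fun t => φ v w t), if_pos (by simp; omega)]
      rw [h4]
      split_ifs with h
      · have h5 := hin w t h.1 h.2
        have h6 := hload w (t + 1) h.1 h.2
        omega
      · have := hcap w t (by omega)
        omega
  obtain ⟨f, hf, hfx⟩ := exists_injOn_of_weights A B x hN hA hB
  refine exists_isSchedule_of_injOn M hM X H E hD f ?_ ?_ ?_ ?_
  · intro v t w u hv ht hw hu h
    have := hf ((memA (v, t)).mpr ⟨hv, ht⟩) ((memA (w, u)).mpr ⟨hw, hu⟩) h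
    simpa using this
  · intro v t hv ht
    obtain ⟨-, h2⟩ := hfx (v, t) ((memA (v, t)).mpr ⟨hv, ht⟩)
    by_cases h : f (v, t) = (v, t)
    · exact Or.inl h
    · right
      simp only [x, if_neg h, add_zero] at h2
      split_ifs at h2 with h3
      · exact ⟨(f (v, t)).1, by rw [← h3], hφM _ _ _ h2⟩
      · omega
  · intro v hv h
    obtain ⟨h1, -⟩ := hfx (v, 0) ((memA (v, 0)).mpr ⟨Finset.disjoint_left.mp hHX hv, hD⟩)
    rw [h] at h1
    exact ((memB _).mp h1).2.1 rfl hv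
  · intro v t w hv ht h
    obtain ⟨h1, -⟩ := hfx (v, t) ((memA (v, t)).mpr ⟨hv, ht⟩)
    rw [h] at h1
    exact ((memB _).mp h1).2.2 rfl

/-- If the agents of `P` alone can evacuate within time `T`, then the agents of `S ∪ P` have a
schedule of length `3 * T` after which precisely `S` is occupied (or fewer vertices). -/
theorem exists_isSchedule_union {V : Type} [Fintype V] [DecidableEq V] (M : V → V → Prop)
    (hM : ∀ v, M v v) (X S P : Finset V) (hSP : Disjoint S P) (hSX : Disjoint (S ∪ P) X) {T : ℕ}
    (hT : 0 < T) (q : V → ℕ → V) (s : V → ℕ)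
    (hq0 : ∀ p ∈ P, q p 0 = p) (hs : ∀ p ∈ P, s p ≤ T)
    (hmove : ∀ p ∈ P, ∀ t < s p, M (q p t) (q p (t + 1)))
    (hexit : ∀ p ∈ P, q p (s p) ∈ X)
    (hcoll : ∀ p ∈ P, ∀ p' ∈ P, p ≠ p' → ∀ t, 1 ≤ t → t ≤ s p → t ≤ s p' → q p t ≠ q p' t) :
    ∃ r, IsSchedule M X (S ∪ P) S (3 * T) r := by
  classical
  -- Every agent is split into `2 * T` units. A vertex of `P` releases one unit in each of the first
  -- `2 * T` steps, while vertices of `S` keep a constant stock.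
  let base : V → ℕ → ℕ := fun v t => if v ∈ S then 2 * T else if v ∈ P then 2 * T - t else 0
  -- At most `T` tokens arrive at once, so with a stock of at least `T` the arrivals can replace
  -- units that leave in the same step. Thus a token may traverse several edges in one step although
  -- no unit does.
  let fast : V → ℕ → Prop := fun v t => T ≤ base v (t + 1)
  have hfast : ∀ v t t', fast v t' → t ≤ t' → fast v t := by
    intro v t t' h htt
    refine le_trans h ?_
    simp only [base]
    split_ifs <;> omega
  -- The triple `(p, i, k)` stands for move `k` (counted from `0`) along the route of `p` of the
  -- token released at time `i`.
  let time : V × ℕ × ℕ → ℕ := fun c => departTime fast (q c.1) c.2.1 c.2.2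
  obtain ⟨tok, mem_tok⟩ : ∃ tok : Finset (V × ℕ × ℕ),
      ∀ p i k, (p, i, k) ∈ tok ↔ p ∈ P ∧ i < 2 * T ∧ k < s p := by
    refine ⟨(P ×ˢ Finset.range (2 * T) ×ˢ Finset.range T).filter fun c => c.2.2 < s c.1, ?_⟩
    intro p i k
    simp only [Finset.mem_filter, Finset.mem_product, Finset.mem_range]
    constructor
    · rintro ⟨⟨h1, h2, h3⟩, h4⟩; exact ⟨h1, h2, h4⟩
    · rintro ⟨h1, h2, h3⟩; exact ⟨⟨h1, h2, h3.trans_le (hs p h1)⟩, h3⟩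
  let mv : V → V → ℕ → ℕ := fun v w t =>
    (tok.filter fun c => (q c.1 c.2.2 = v ∧ q c.1 (c.2.2 + 1) = w) ∧ time c = t).card
  let dep : V → ℕ → ℕ := fun v t => (tok.filter fun c => q c.1 c.2.2 = v ∧ time c = t).card
  let arr : V → ℕ → ℕ := fun w t => (tok.filter fun c => q c.1 (c.2.2 + 1) = w ∧ time c = t).card
  let slow : V → ℕ → ℕ := fun v t => if t = 0 ∨ fast v (t - 1) then 0 else arr v (t - 1)
  let quick : V → ℕ → ℕ := fun v t => if fast v t then arr v t else 0
  have mv_dep : ∀ v t, ∑ w, mv v w t = dep v t := by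
    intro v t
    simp only [dep, mv]
    rw [Finset.card_eq_sum_card_fiberwise (f := fun c => q c.1 (c.2.2 + 1)) (t := Finset.univ)
      (fun _ _ => Finset.mem_coe.mpr (Finset.mem_univ _))]
    refine Finset.sum_congr rfl fun w _ => ?_
    rw [Finset.filter_filter]
    congr 1
    ext c
    simp only [Finset.mem_filter]
    tauto
  have mv_arr : ∀ w t, ∑ v ∈ Xᶜ, mv v w t ≤ arr w t := by
    intro w t
    refine (Finset.sum_le_sum_of_subset (Finset.subset_univ _)).trans (le_of_eq ?_)
    simp only [arr, mv]
    symm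
    rw [Finset.card_eq_sum_card_fiberwise (f := fun c => q c.1 c.2.2) (t := Finset.univ)
      (fun _ _ => Finset.mem_coe.mpr (Finset.mem_univ _))]
    refine Finset.sum_congr rfl fun w _ => ?_
    rw [Finset.filter_filter]
    congr 1
    ext c
    simp only [Finset.mem_filter]
    tauto
  -- For each `k < T` at most one token makes its move `k` to `w` at time `t`: the given routes do
  -- not collide, which determines `p`, and departure times are strictly increasing in `i`.
  have arr_le : ∀ w t, arr w t ≤ T := by
    intro w t
    simp only [arr]
    conv_rhs => rw [← Finset.card_range T]
    refine Finset.card_le_card_of_injOn (fun c => c.2.2) ?_ ?_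
    · rintro ⟨p, i, k⟩ hc
      have hc := (Finset.mem_filter.mp (Finset.mem_coe.mp hc)).1
      obtain ⟨h1, -, h2⟩ := (mem_tok _ _ _).mp hc
      exact Finset.mem_coe.mpr (Finset.mem_range.mpr (h2.trans_le (hs p h1)))
    · rintro ⟨p, i, k⟩ hc ⟨p', i', k'⟩ hc' hk
      simp only at hk
      subst hk
      obtain ⟨hc, h1, h2⟩ := Finset.mem_filter.mp (Finset.mem_coe.mp hc)
      obtain ⟨hc', h1', h2'⟩ := Finset.mem_filter.mp (Finset.mem_coe.mp hc')
      obtain ⟨hp, -, hk⟩ := (mem_tok _ _ _).mp hc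
      obtain ⟨hp', -, hk'⟩ := (mem_tok _ _ _).mp hc'
      have hpp : p = p' := by
        by_contra hne
        exact hcoll p hp p' hp' hne (k + 1) (by omega) hk hk' (h1.trans h1'.symm)
      subst hpp
      have := (departTime_strictMono fast (q p) hfast k).injective (h2.trans h2'.symm)
      exact congrArg (fun i => (p, i, k)) this
  have arr_zero : ∀ w t, 3 * T - 1 ≤ t → arr w t = 0 := by
    intro w t ht
    refine Finset.card_eq_zero.mpr (Finset.filter_eq_empty_iff.mpr ?_)
    rintro ⟨p, i, k⟩ hc ⟨-, h2⟩
    obtain ⟨hp, hi, hk⟩ := (mem_tok _ _ _).mp hc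
    have h3 := departTime_le fast (q p) i k
    have h4 := hs p hp
    simp only [time] at h2
    omega
  have quick_le : ∀ v t, quick v t ≤ base v (t + 1) := by
    intro v t
    simp only [quick]
    split_ifs with h
    · exact (arr_le v t).trans h
    · exact Nat.zero_le _
  have load_le : ∀ v t, base v t + slow v t ≤ 2 * T := by
    intro v t
    have hb : base v t ≤ 2 * T := by simp only [base]; split_ifs <;> omega
    simp only [slow]
    split_ifs with h
    · omega
    · push Not at h
      have h1 := h.2
      simp only [fast, Nat.sub_add_cancel (Nat.pos_of_ne_zero h.1), not_le] at h1
      have := arr_le v (t - 1)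
      omega
  have arr_split : ∀ v t, arr v t = quick v t + slow v (t + 1) := by
    intro v t
    simp only [quick, slow, Nat.add_sub_cancel]
    split_ifs <;> simp_all
  -- Departures consist of newly released tokens, slow arrivals of the previous step and quick
  -- arrivals of the same step. Outside `X` each arrival is followed by a departure, since a route
  -- ends only at an exit.
  have dep_eq : ∀ w t, w ∉ X → dep w t =
      (if w ∈ P ∧ t < 2 * T then 1 else 0) + slow w t + quick w t := by
    intro w t hw
    have h0 : dep w t = (tok.filter fun c => (q c.1 c.2.2 = w ∧ time c = t) ∧ c.2.2 = 0).card +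
        (tok.filter fun c => (q c.1 c.2.2 = w ∧ time c = t) ∧ ¬ c.2.2 = 0).card := by
      simp only [dep]
      rw [← Finset.card_filter_add_card_filter_not (fun c => c.2.2 = 0), Finset.filter_filter,
        Finset.filter_filter]
    have h1 : (tok.filter fun c => (q c.1 c.2.2 = w ∧ time c = t) ∧ c.2.2 = 0).card =
        if w ∈ P ∧ t < 2 * T then 1 else 0 := by
      split_ifs with h
      · rw [Finset.card_eq_one]
        refine ⟨(w, t, 0), ?_⟩
        ext ⟨p, i, k⟩
        simp only [Finset.mem_filter, mem_tok, Finset.mem_singleton, Prod.mk.injEq, time]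
        constructor
        · rintro ⟨⟨hp, -, -⟩, ⟨h1, h2⟩, rfl⟩
          rw [hq0 p hp] at h1
          exact ⟨h1, h2, rfl⟩
        · rintro ⟨rfl, rfl, rfl⟩
          refine ⟨⟨h.1, h.2, ?_⟩, ⟨hq0 _ h.1, rfl⟩, rfl⟩
          by_contra h0
          have h3 := hexit _ h.1
          rw [Nat.eq_zero_of_not_pos h0, hq0 _ h.1] at h3
          exact hw h3
      · refine Finset.card_eq_zero.mpr (Finset.filter_eq_empty_iff.mpr ?_)
        rintro ⟨p, i, k⟩ hc ⟨⟨h1, h2⟩, h3⟩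
        simp only at h1 h3
        subst h3
        obtain ⟨hp, hi, -⟩ := (mem_tok _ _ _).mp hc
        rw [hq0 p hp] at h1
        simp only [time, departTime] at h2
        subst h1 h2
        exact h ⟨hp, hi⟩
    have h2 : (tok.filter fun c => (q c.1 c.2.2 = w ∧ time c = t) ∧ ¬ c.2.2 = 0).card =
        (tok.filter fun c => q c.1 (c.2.2 + 1) = w ∧ time (c.1, c.2.1, c.2.2 + 1) = t).card := by
      symm
      refine Finset.card_bij (fun c _ => (c.1, c.2.1, c.2.2 + 1)) ?_ ?_ ?_
      · rintro ⟨p, i, k⟩ hc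
        obtain ⟨hc, h1, h2⟩ := Finset.mem_filter.mp hc
        obtain ⟨hp, hi, hk⟩ := (mem_tok _ _ _).mp hc
        simp only at h1 h2
        refine Finset.mem_filter.mpr ⟨(mem_tok _ _ _).mpr ⟨hp, hi, ?_⟩, ⟨h1, h2⟩, by simp⟩
        refine lt_of_le_of_ne hk fun h => hw ?_
        rw [← h1, h]
        exact hexit p hp
      · rintro ⟨p, i, k⟩ _ ⟨p', i', k'⟩ _ h
        simpa using h
      · rintro ⟨p, i, k⟩ hc
        obtain ⟨hc, ⟨h1, h2⟩, h3⟩ := Finset.mem_filter.mp hc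
        obtain ⟨hp, hi, hk⟩ := (mem_tok _ _ _).mp hc
        simp only at h1 h2 h3
        obtain ⟨k, rfl⟩ : ∃ k', k = k' + 1 := ⟨k - 1, by omega⟩
        exact ⟨(p, i, k), Finset.mem_filter.mpr ⟨(mem_tok _ _ _).mpr ⟨hp, hi, by omega⟩, h1, h2⟩,
          rfl⟩
    have h3 : (tok.filter fun c => q c.1 (c.2.2 + 1) = w ∧ time (c.1, c.2.1, c.2.2 + 1) = t).card =
        slow w t + quick w t := by
      rw [← Finset.card_filter_add_card_filter_not (fun c => fast w (time c)), Finset.filter_filter,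
        Finset.filter_filter, add_comm]
      congr 1
      · simp only [slow]
        split_ifs with h
        · refine Finset.card_eq_zero.mpr (Finset.filter_eq_empty_iff.mpr ?_)
          rintro ⟨p, i, k⟩ hc ⟨⟨h1, h2⟩, h3⟩
          simp only [time, departTime] at h1 h2 h3
          rw [h1, if_neg h3] at h2
          rcases h with h | h
          · omega
          · exact h3 (by rw [← h2, Nat.add_sub_cancel] at h; exact h)
        · push Not at h
          simp only [arr]
          congr 1
          refine Finset.filter_congr ?_
          rintro ⟨p, i, k⟩ hc
          simp only [time, departTime]
          constructor
          · rintro ⟨⟨h1, h2⟩, h3⟩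
            rw [h1, if_neg h3] at h2
            exact ⟨h1, by omega⟩
          · rintro ⟨h1, h2⟩
            rw [h1, h2, if_neg h.2]
            exact ⟨⟨rfl, by omega⟩, h.2⟩
      · simp only [quick]
        split_ifs with h
        · simp only [arr]
          congr 1
          refine Finset.filter_congr ?_
          rintro ⟨p, i, k⟩ hc
          simp only [time, departTime]
          constructor
          · rintro ⟨⟨h1, h2⟩, h3⟩
            rw [h1, if_pos h3] at h2
            exact ⟨h1, h2⟩
          · rintro ⟨h1, h2⟩
            rw [h1, h2, if_pos h]
            exact ⟨⟨rfl, rfl⟩, h⟩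
        · refine Finset.card_eq_zero.mpr (Finset.filter_eq_empty_iff.mpr ?_)
          rintro ⟨p, i, k⟩ hc ⟨⟨h1, h2⟩, h3⟩
          simp only [time, departTime] at h1 h2 h3
          rw [h1, if_pos h3] at h2
          exact h (h2 ▸ h3)
    rw [h0, h1, h2, h3, add_assoc]
  have base_step : ∀ w t, base w t = (if w ∈ P ∧ t < 2 * T then 1 else 0) + base w (t + 1) := by
    intro w t
    simp only [base]
    by_cases hS : w ∈ S
    · have : w ∉ P := Finset.disjoint_left.mp hSP hS
      simp [hS, this]
    · by_cases hP : w ∈ P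
      · simp only [hS, hP, if_false, if_true, true_and]
        split_ifs <;> omega
      · simp [hS, hP]
  -- Tokens are released before time `2 * T` and make at most `T` moves, hence all is over by time
  -- `3 * T`. Stock not replaced by quick arrivals flows along the edge that stays at `v`.
  refine exists_isSchedule_of_flow M hM X (S ∪ P) S hSX (D := 3 * T) (N := 2 * T) (by omega)
    (by omega) (fun v t => base v t + slow v t)
    (fun v w t => mv v w t + if w = v then base v (t + 1) - quick v t else 0) ?_ ?_ ?_ ?_ ?_ ?_ ?_
  · intro v w t h
    by_cases hvw : w = v
    · rw [hvw]; exact hM v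
    · rw [if_neg hvw, add_zero] at h
      obtain ⟨⟨p, i, k⟩, hc⟩ := Finset.card_pos.mp h
      obtain ⟨hc, ⟨h1, h2⟩, -⟩ := Finset.mem_filter.mp hc
      obtain ⟨hp, hi, hk⟩ := (mem_tok _ _ _).mp hc
      rw [← h1, ← h2]
      exact hmove p hp k hk
  · intro v t _ _
    exact load_le v t
  · intro v hv
    rcases Finset.mem_union.mp hv with hv | hv
    · simp [base, slow, hv]
    · have : v ∉ S := Finset.disjoint_right.mp hSP hv
      simp [base, slow, hv, this]
  · intro v t hv _
    rw [Finset.sum_add_distrib, mv_dep, Finset.sum_ite_eq' Finset.univ v, if_pos (Finset.mem_univ v),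
      dep_eq v t hv, base_step v t]
    have := quick_le v t
    omega
  · intro w t hw _
    rw [Finset.sum_add_distrib, Finset.sum_ite_eq, if_pos (by simpa using hw)]
    have h1 := mv_arr w t
    have h2 := arr_split w t
    have h3 := quick_le w t
    omega
  · intro w t _
    rw [Finset.sum_add_distrib, Finset.sum_ite_eq]
    have h1 := mv_arr w t
    have h2 := arr_split w t
    have h3 := quick_le w t
    have h4 := load_le w (t + 1)
    split_ifs
    · omega
    · have := arr_le w t
      omega
  · intro v w hv hw hwS
    have h1 : mv v w (3 * T - 1) = 0 := by
      refine Nat.le_zero.mp ?_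
      rw [← arr_zero w (3 * T - 1) le_rfl]
      refine le_trans ?_ (mv_arr w _)
      exact Finset.single_le_sum (f := fun v => mv v w (3 * T - 1)) (fun _ _ => Nat.zero_le _)
        (by simpa using hv)
    have h2 : base w (3 * T - 1 + 1) = 0 := by
      simp only [base, hwS, if_false]
      split_ifs <;> omega
    rw [h1, zero_add]
    split_ifs with h
    · rw [← h, h2, Nat.zero_sub]
    · rfl

/-! ### Odd-even transposition on a path -/

/-- The cell of the path `0, …, n - 1` visited at time `x` by a walk that bounces between its ends,
resting for one step at each end. -/
def bounce (n x : ℕ) : ℕ :=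
  if x % (2 * n) < n then x % (2 * n) else 2 * n - 1 - x % (2 * n)

/-- The position at time `t` of the agent starting at `j` in an odd-even transposition network on the
path `0, …, n - 1`. -/
def exchange (n j t : ℕ) : ℕ :=
  bounce n ((if j % 2 = 0 then j else 2 * n - 1 - j) + t)

theorem exchange_zero {n j : ℕ} (hj : j < n) : exchange n j 0 = j := by
  unfold exchange bounce
  rw [add_zero]
  have : (if j % 2 = 0 then j else 2 * n - 1 - j) < 2 * n := by split_ifs <;> omega
  rw [Nat.mod_eq_of_lt this]
  split_ifs <;> omega

theorem exchange_lt {n : ℕ} (hn : 0 < n) (j t : ℕ) : exchange n j t < n := by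
  unfold exchange bounce
  have := Nat.mod_lt ((if j % 2 = 0 then j else 2 * n - 1 - j) + t) (show 0 < 2 * n by omega)
  split_ifs at * <;> omega

theorem bounce_succ {n : ℕ} (hn : 0 < n) (x : ℕ) :
    bounce n (x + 1) ≤ bounce n x + 1 ∧ bounce n x ≤ bounce n (x + 1) + 1 := by
  unfold bounce
  have h1 := Nat.mod_lt x (show 0 < 2 * n by omega)
  rw [Nat.add_mod_eq_ite]
  by_cases h : n = 1
  · subst h
    split_ifs <;> omega
  · rw [Nat.mod_eq_of_lt (show 1 < 2 * n by omega)]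
    split_ifs <;> omega

theorem exchange_succ {n : ℕ} (hn : 0 < n) (j t : ℕ) :
    exchange n j (t + 1) ≤ exchange n j t + 1 ∧ exchange n j t ≤ exchange n j (t + 1) + 1 :=
  bounce_succ hn _

/-- All agents rotate along a cycle of length `2 * n` that is folded onto the path by identifying
`x` with `2 * n - 1 - x`. These have different parities, whereas all agents start at even places of
the cycle, so the folding causes no collision. -/
theorem exchange_injective {n j j' t : ℕ} (hj : j < n) (hj' : j' < n)
    (h : exchange n j t = exchange n j' t) : j = j' := by
  unfold exchange bounce at h
  have hs : (if j % 2 = 0 then j else 2 * n - 1 - j) < 2 * n := by split_ifs <;> omega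
  have hs' : (if j' % 2 = 0 then j' else 2 * n - 1 - j') < 2 * n := by split_ifs <;> omega
  have he : (if j % 2 = 0 then j else 2 * n - 1 - j) % 2 = 0 := by split_ifs <;> omega
  have he' : (if j' % 2 = 0 then j' else 2 * n - 1 - j') % 2 = 0 := by split_ifs <;> omega
  have hinj : (if j % 2 = 0 then j else 2 * n - 1 - j) =
      (if j' % 2 = 0 then j' else 2 * n - 1 - j') → j = j' := by
    split_ifs <;> omega
  generalize (if j % 2 = 0 then j else 2 * n - 1 - j) = a at *
  generalize (if j' % 2 = 0 then j' else 2 * n - 1 - j') = b at *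
  apply hinj
  have h1 := Nat.mod_mod_of_dvd (a + t) (Nat.dvd_mul_right 2 n)
  have h2 := Nat.mod_mod_of_dvd (b + t) (Nat.dvd_mul_right 2 n)
  have h3 := Nat.mod_lt (a + t) (show 0 < 2 * n by omega)
  have h4 := Nat.mod_lt (b + t) (show 0 < 2 * n by omega)
  have h5 : (a + t) % (2 * n) = (b + t) % (2 * n) := by
    split_ifs at h <;> omega
  have h6 : a ≡ b [MOD 2 * n] := Nat.ModEq.add_right_cancel' t h5
  unfold Nat.ModEq at h6
  rwa [Nat.mod_eq_of_lt hs, Nat.mod_eq_of_lt hs'] at h6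

theorem exchange_self {n j : ℕ} (hj : j < n) : exchange n j n = n - 1 - j := by
  unfold exchange bounce
  by_cases h : j % 2 = 0
  · rw [if_pos h, Nat.mod_eq_of_lt (show j + n < 2 * n by omega)]
    split_ifs <;> omega
  · rw [if_neg h]
    have : 2 * n - 1 - j + n = n - 1 - j + 2 * n := by omega
    rw [this, Nat.add_mod_right, Nat.mod_eq_of_lt (by omega)]
    split_ifs <;> omega

/-- Any two agents become neighbours at some time. -/
theorem exchange_meet {n j j' : ℕ} (hj : j < j') (hj' : j' < n) :
    ∃ t < n, exchange n j t + 1 = exchange n j' t ∨ exchange n j' t + 1 = exchange n j t := by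
  by_contra! hcon
  -- Without becoming neighbours the two could not change their order, but at time `n` the order of
  -- all agents is reversed.
  have : ∀ t ≤ n, exchange n j t < exchange n j' t := by
    intro t
    induction t with
    | zero => intro _; rwa [exchange_zero (by omega), exchange_zero hj']
    | succ t ih =>
      intro ht
      have h1 := ih (by omega)
      have h2 := hcon t (by omega)
      have h3 := exchange_succ (show 0 < n by omega) j t
      have h4 := exchange_succ (show 0 < n by omega) j' t
      have h5 : exchange n j (t + 1) ≠ exchange n j' (t + 1) := fun h => by
        have := exchange_injective (by omega) hj' h
        omega
      omega
  have := this n le_rfl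
  rw [exchange_self (by omega), exchange_self hj'] at this
  omega

/-! ### Interval partitions and their shifts -/

/-- A partition of `{0, …, m - 1}` into intervals of length at most `W`: the interval containing `i`
starts at `lo i` and has length `len i`. -/
structure IntervalPartition (m W : ℕ) where
  lo : ℕ → ℕ
  len : ℕ → ℕ
  lo_le : ∀ i < m, lo i ≤ i
  lt_add : ∀ i < m, i < lo i + len i
  add_le : ∀ i < m, lo i + len i ≤ m
  len_le : ∀ i < m, len i ≤ W
  eq_of_mem : ∀ i < m, ∀ i', lo i ≤ i' → i' < lo i + len i → lo i' = lo i ∧ len i' = len i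

namespace IntervalPartition
variable {m W : ℕ} (π : IntervalPartition m W)

/-- The odd-even transposition network on each interval. -/
def swap (i t : ℕ) : ℕ := π.lo i + exchange (π.len i) (i - π.lo i) t

theorem swap_zero {i : ℕ} (hi : i < m) : π.swap i 0 = i := by
  have h1 := π.lo_le i hi
  have h2 := π.lt_add i hi
  unfold swap
  rw [exchange_zero (by omega)]
  omega

theorem swap_mem {i : ℕ} (hi : i < m) (t : ℕ) :
    π.lo i ≤ π.swap i t ∧ π.swap i t < π.lo i + π.len i := by
  have h1 := π.lo_le i hi
  have h2 := π.lt_add i hi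
  have := exchange_lt (show 0 < π.len i by omega) (i - π.lo i) t
  unfold swap
  omega

theorem swap_lt {i : ℕ} (hi : i < m) (t : ℕ) : π.swap i t < m :=
  (π.swap_mem hi t).2.trans_le (π.add_le i hi)

theorem lo_swap {i : ℕ} (hi : i < m) (t : ℕ) : π.lo (π.swap i t) = π.lo i :=
  (π.eq_of_mem i hi _ (π.swap_mem hi t).1 (π.swap_mem hi t).2).1

theorem swap_succ {i : ℕ} (hi : i < m) (t : ℕ) :
    π.swap i (t + 1) ≤ π.swap i t + 1 ∧ π.swap i t ≤ π.swap i (t + 1) + 1 := by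
  have h1 := π.lo_le i hi
  have h2 := π.lt_add i hi
  have := exchange_succ (show 0 < π.len i by omega) (i - π.lo i) t
  unfold swap
  omega

theorem len_eq {i i' : ℕ} (hi : i < m) (hi' : i' < m) (h : π.lo i = π.lo i') :
    π.len i = π.len i' := by
  have h1 := π.lo_le i hi
  have h2 := π.lt_add i hi
  have h3 := π.lo_le i' hi'
  have h4 := π.lt_add i' hi'
  by_cases hlt : i < π.lo i' + π.len i'
  · exact (π.eq_of_mem i' hi' i (by omega) hlt).2
  · exact (π.eq_of_mem i hi i' (by omega) (by omega)).2.symm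

theorem swap_injective {i i' t : ℕ} (hi : i < m) (hi' : i' < m) (h : π.swap i t = π.swap i' t) :
    i = i' := by
  have hlo : π.lo i = π.lo i' := by rw [← π.lo_swap hi t, h, π.lo_swap hi' t]
  have hlen := π.len_eq hi hi' hlo
  have h1 := π.lo_le i hi
  have h2 := π.lt_add i hi
  have h3 := π.lo_le i' hi'
  have h4 := π.lt_add i' hi'
  unfold swap at h
  rw [hlo, hlen] at h
  have := exchange_injective (n := π.len i') (by omega) (by omega) (Nat.add_left_cancel h)
  omega

theorem swap_meet {i i' : ℕ} (hi : i < m) (hi' : i' < m) (hne : i ≠ i') (hlo : π.lo i = π.lo i') :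
    ∃ t < W, π.swap i t + 1 = π.swap i' t ∨ π.swap i' t + 1 = π.swap i t := by
  wlog h : i < i' generalizing i i'
  · obtain ⟨t, ht, h⟩ := this hi' hi hne.symm hlo.symm (by omega)
    exact ⟨t, ht, h.symm⟩
  have hlen := π.len_eq hi hi' hlo
  have h1 := π.lo_le i hi
  have h2 := π.lt_add i hi
  have h3 := π.lo_le i' hi'
  have h4 := π.lt_add i' hi'
  obtain ⟨t, ht, h⟩ := exchange_meet (n := π.len i) (j := i - π.lo i) (j' := i' - π.lo i')
    (by omega) (by omega)
  refine ⟨t, ht.trans_le (π.len_le i hi), ?_⟩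
  unfold swap
  rw [← hlen, ← hlo] at *
  omega

/-- The partition into intervals of length `3 * L`, shifted by `s * L`. -/
def shifted (m : ℕ) {L : ℕ} (hL : 0 < L) (s : ℕ) : IntervalPartition m (3 * L) where
  -- Truncated subtraction cuts the first interval off at `0`, and the minimum with `m` cuts off the
  -- last one.
  lo i := 3 * L * ((i + s * L) / (3 * L)) - s * L
  len i := min m (3 * L * ((i + s * L) / (3 * L) + 1) - s * L) -
    (3 * L * ((i + s * L) / (3 * L)) - s * L)
  lo_le i hi := by
    have := Nat.mul_div_le (i + s * L) (3 * L)
    omega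
  lt_add i hi := by
    have := Nat.mul_div_le (i + s * L) (3 * L)
    have := Nat.lt_mul_div_succ (i + s * L) (show 0 < 3 * L by omega)
    omega
  add_le i hi := by
    have := Nat.mul_div_le (i + s * L) (3 * L)
    have := Nat.lt_mul_div_succ (i + s * L) (show 0 < 3 * L by omega)
    omega
  len_le i hi := by
    rw [mul_add]
    omega
  eq_of_mem i hi i' h1 h2 := by
    have h3 := Nat.mul_div_le (i + s * L) (3 * L)
    have h4 := Nat.lt_mul_div_succ (i + s * L) (show 0 < 3 * L by omega)
    have : (i' + s * L) / (3 * L) = (i + s * L) / (3 * L) := by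
      rw [Nat.div_eq_iff (by omega)]
      rw [mul_comm (3 * L), mul_comm (3 * L), add_mul] at *
      omega
    rw [this]
    exact ⟨rfl, rfl⟩

/-- A point in the middle third of its interval is at distance at least `L` from every interval
boundary inside the path. -/
theorem shifted_lo_eq {m L : ℕ} (hL : 0 < L) {s i i' : ℕ}
    (hc : (i + s * L) / L % 3 = 1) (h1 : i ≤ i' + L) (h2 : i' ≤ i + L) :
    (shifted m hL s).lo i' = (shifted m hL s).lo i := by
  have : (i' + s * L) / (3 * L) = (i + s * L) / (3 * L) := by
    have h3 := Nat.mul_div_le (i + s * L) L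
    have h4 := Nat.lt_mul_div_succ (i + s * L) hL
    have h5 : (i + s * L) / (3 * L) = (i + s * L) / L / 3 := by
      rw [Nat.div_div_eq_div_mul, mul_comm L 3]
    obtain ⟨c, hcc⟩ : ∃ c, (i + s * L) / L = 3 * c + 1 := ⟨(i + s * L) / L / 3, by omega⟩
    rw [h5, hcc, show (3 * c + 1) / 3 = c by omega, Nat.div_eq_iff (by omega)]
    rw [hcc] at h3 h4
    ring_nf at h3 h4 ⊢
    omega
  simp only [shifted, this]

/-- Shifting by `s * L` adds `s` to the index of the block of length `L`, so one of three shifts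
makes it `1` modulo `3`. -/
theorem exists_shift (i : ℕ) {L : ℕ} (hL : 0 < L) : ∃ s < 3, (i + s * L) / L % 3 = 1 := by
  refine ⟨(4 - i / L % 3) % 3, Nat.mod_lt _ (by omega), ?_⟩
  rw [Nat.add_mul_div_right _ _ hL]
  omega

end IntervalPartition

/-! ### Phases and the algorithm that executes them -/

/-- A phase of a distributed algorithm: its duration and the trajectories `traj S v` of the agents
starting at `v`, where `S` is the set of all vertices occupied at its beginning. -/
structure Phase (V : Type) where
  dur : ℕ
  traj : Finset V → V → ℕ → V

section
variable {V : Type}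

/-- The total duration of a sequence of phases. -/
def total (ps : List (Phase V)) : ℕ := (ps.map Phase.dur).sum

/-- The phase to be carried out in step `t + 1`, and the time since its beginning. -/
def locate : List (Phase V) → ℕ → Option (Phase V × ℕ)
  | [], _ => none
  | p :: ps, t => if t < p.dur then some (p, t) else locate ps (t - p.dur)

theorem locate_append (qs : List (Phase V)) (p : Phase V) (ps : List (Phase V)) {t : ℕ}
    (ht : t < p.dur) : locate (qs ++ p :: ps) (total qs + t) = some (p, t) := by
  induction qs with
  | nil => simp [locate, total, ht]
  | cons q qs ih =>
    have h1 : total (q :: qs) = q.dur + total qs := by simp [total]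
    rw [List.cons_append, locate, if_neg (by omega), h1]
    rw [show q.dur + total qs + t - q.dur = total qs + t by omega]
    exact ih

theorem total_append (ps qs : List (Phase V)) : total (ps ++ qs) = total ps + total qs := by
  simp [total]

theorem total_cons (p : Phase V) (ps : List (Phase V)) : total (p :: ps) = p.dur + total ps := by
  simp [total]

end

theorem state_succ {V : Type} {G : SimpleGraph V} {X H : Finset V} (A : DistributedAlgorithm V) (t : ℕ) :
    A.state G X H (t + 1) = A.step G X H (A.state G X H t) := by
  unfold DistributedAlgorithm.state
  rw [Function.iterate_succ_apply']

section
variable {V : Type} [DecidableEq V] (G : SimpleGraph V) (X : Finset V)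

open Classical in
/-- The vertices known at time `t` to the agent starting at `v` to be occupied at the beginning of
the phase, if all agents within range exchange their knowledge once per step. -/
noncomputable def Phase.know (p : Phase V) (S : Finset V) : ℕ → V → Finset V
  | 0, v => {v}
  | t + 1, v => p.know S t v ∪
      (S.filter fun w => w ≠ v ∧ p.traj S w t ∉ X ∧ InRange G (p.traj S v t) (p.traj S w t)).biUnion
        fun w => p.know S t w

/-- The phase can be carried out from the occupied set `S`. -/
structure Phase.Ok (p : Phase V) (S : Finset V) : Prop where
  sched : IsSchedule (fun u v => v = u ∨ G.Adj u v) X S S p.dur (p.traj S)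
  loc : ∀ v ∈ S, ∀ t < p.dur, p.traj S v t ∉ X →
    p.traj (p.know G X S (t + 1) v) v (t + 1) = p.traj S v (t + 1)

/-- The vertices occupied after the phase. -/
def Phase.next (p : Phase V) (S : Finset V) : Finset V :=
  (S.image fun v => p.traj S v p.dur).filter fun v => v ∉ X

/-- The vertices occupied after a sequence of phases. -/
def nexts : List (Phase V) → Finset V → Finset V
  | [], S => S
  | p :: ps, S => nexts ps (p.next X S)

/-- The sequence of phases can be carried out. -/
def Oks : List (Phase V) → Finset V → Prop
  | [], _ => True
  | p :: ps, S => p.Ok G X S ∧ Oks ps (p.next X S)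

theorem nexts_append (ps qs : List (Phase V)) (S : Finset V) :
    nexts X (ps ++ qs) S = nexts X qs (nexts X ps S) := by
  induction ps generalizing S with
  | nil => rfl
  | cons p ps ih => exact ih _

/-- The algorithm carrying out a sequence of phases. The memory holds the time, the location at the
beginning of the phase, and the known locations of agents at that time. -/
noncomputable def algorithm [Fintype V] (Φ : List (Phase V)) : DistributedAlgorithm V where
  Mem := Fin (total Φ + 1) × V × Finset V
  finite_mem := inferInstance
  Msg := Finset V
  rounds := 1
  init v := (0, v, {v})
  send _ μ := μ.2.2
  receive _ μ f := (μ.1, μ.2.1, μ.2.2 ∪ Finset.univ.biUnion fun v => (f v).getD ∅)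
  act u μ := match locate Φ μ.1.val with
    | none => (μ, u)
    | some (p, t) =>
      if t + 1 = p.dur then
        ((Fin.ofNat _ (μ.1.val + 1), p.traj μ.2.2 μ.2.1 (t + 1), {p.traj μ.2.2 μ.2.1 (t + 1)}),
          p.traj μ.2.2 μ.2.1 (t + 1))
      else ((Fin.ofNat _ (μ.1.val + 1), μ.2.1, μ.2.2), p.traj μ.2.2 μ.2.1 (t + 1))

variable [Fintype V] (Φ : List (Phase V)) (H : Finset V)

/-- At time `t` a phase begins, the vertices in `S` being occupied. -/
structure IsClean (t : ℕ) (S : Finset V) : Prop where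
  le : t ≤ total Φ
  mem : ∀ a : H, ((algorithm Φ).state G X H t a).loc ∉ X →
    ((algorithm Φ).state G X H t a).mem = (Fin.ofNat _ t, ((algorithm Φ).state G X H t a).loc,
      {((algorithm Φ).state G X H t a).loc})
  inj : ∀ a b : H, a ≠ b → ((algorithm Φ).state G X H t a).loc ∉ X →
    ((algorithm Φ).state G X H t b).loc ∉ X →
    ((algorithm Φ).state G X H t a).loc ≠ ((algorithm Φ).state G X H t b).loc
  mem_iff : ∀ v, v ∈ S ↔ v ∉ X ∧ ∃ a, ((algorithm Φ).state G X H t a).loc = v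

theorem isClean_zero (hHX : Disjoint H X) : IsClean G X Φ H 0 H where
  le := Nat.zero_le _
  mem _ _ := rfl
  inj _ _ hab _ _ h := hab (Subtype.ext h)
  mem_iff v := ⟨fun hv => ⟨Finset.disjoint_left.mp hHX hv, ⟨v, hv⟩, rfl⟩,
    fun ⟨_, a, ha⟩ => ha ▸ a.2⟩

variable {G X Φ H}

theorem algorithm_act {u v : V} {K : Finset V} {t t' : ℕ} {p : Phase V} (ht' : t' ≤ total Φ)
    (h : locate Φ t' = some (p, t)) :
    (algorithm Φ).act u (Fin.ofNat (total Φ + 1) t', v, K) = ((Fin.ofNat (total Φ + 1) (t' + 1),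
      if t + 1 = p.dur then (p.traj K v (t + 1), {p.traj K v (t + 1)}) else (v, K)),
      p.traj K v (t + 1)) := by
  have hval : (Fin.ofNat (total Φ + 1) t').val = t' := Nat.mod_eq_of_lt (by omega)
  simp only [algorithm, hval, h]
  split_ifs <;> rfl

/-- Simulation invariant: an agent plans with its partial knowledge in place of `S`, but by
`Phase.Ok.loc` this already determines its next move, so actual positions agree with the global
trajectories and memories with `Phase.know`. -/
theorem state_of_isClean {t₀ : ℕ} {S : Finset V} (hc : IsClean G X Φ H t₀ S) {p : Phase V}
    (hp : p.Ok G X S) (hle : t₀ + p.dur ≤ total Φ)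
    (hloc : ∀ t < p.dur, locate Φ (t₀ + t) = some (p, t)) (t : ℕ) (ht : t ≤ p.dur) (a : H) :
    (((algorithm Φ).state G X H t₀ a).loc ∈ X →
      ((algorithm Φ).state G X H (t₀ + t) a).loc = ((algorithm Φ).state G X H t₀ a).loc) ∧
    (((algorithm Φ).state G X H t₀ a).loc ∉ X →
      ((algorithm Φ).state G X H (t₀ + t) a).loc =
        p.traj S ((algorithm Φ).state G X H t₀ a).loc t ∧
      (p.traj S ((algorithm Φ).state G X H t₀ a).loc t ∉ X →
        ((algorithm Φ).state G X H (t₀ + t) a).mem = (Fin.ofNat _ (t₀ + t),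
          if t = p.dur then (p.traj S ((algorithm Φ).state G X H t₀ a).loc t,
            {p.traj S ((algorithm Φ).state G X H t₀ a).loc t})
          else (((algorithm Φ).state G X H t₀ a).loc,
            p.know G X S t ((algorithm Φ).state G X H t₀ a).loc)))) := by
  classical
  induction t generalizing a with
  | zero =>
    refine ⟨fun _ => rfl, fun h => ?_⟩
    have hS : ((algorithm Φ).state G X H t₀ a).loc ∈ S := (hc.mem_iff _).mpr ⟨h, a, rfl⟩
    rw [hp.sched.start _ hS]
    refine ⟨rfl, fun _ => ?_⟩
    rw [add_zero, hc.mem a h]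
    simp only [Phase.know, ite_self]
    rfl
  | succ t ih =>
    have ih := fun a => ih (by omega) a
    have absorb : ∀ b : H, ((algorithm Φ).state G X H (t₀ + t) b).loc ∉ X →
        ((algorithm Φ).state G X H t₀ b).loc ∉ X := fun b hb h => hb ((ih b).1 h ▸ h)
    have hmem : ∀ b : H, ((algorithm Φ).state G X H (t₀ + t) b).loc ∉ X →
        ((algorithm Φ).state G X H (t₀ + t) b).mem = (Fin.ofNat _ (t₀ + t),
          ((algorithm Φ).state G X H t₀ b).loc,
          p.know G X S t ((algorithm Φ).state G X H t₀ b).loc) := by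
      intro b hb
      have h1 := (ih b).2 (absorb b hb)
      rw [h1.2 (h1.1 ▸ hb), if_neg (by omega)]
    by_cases haX : ((algorithm Φ).state G X H (t₀ + t) a).loc ∈ X
    · have h1 : (algorithm Φ).state G X H (t₀ + (t + 1)) a =
          (algorithm Φ).state G X H (t₀ + t) a := by
        rw [← add_assoc, state_succ]
        simp only [DistributedAlgorithm.step, if_pos haX]
      rw [h1]
      refine ⟨(ih a).1, fun h => ?_⟩
      obtain ⟨h2, -⟩ := (ih a).2 h
      have hS : ((algorithm Φ).state G X H t₀ a).loc ∈ S := (hc.mem_iff _).mpr ⟨h, a, rfl⟩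
      have h3 := hp.sched.absorb _ hS t (by omega) (h2 ▸ haX)
      rw [h3]
      exact ⟨h2, fun h4 => absurd haX (h2 ▸ h4)⟩
    · have h0 := absorb a haX
      refine ⟨fun h => absurd h h0, fun _ => ?_⟩
      obtain ⟨h2, -⟩ := (ih a).2 h0
      have hS : ((algorithm Φ).state G X H t₀ a).loc ∈ S := (hc.mem_iff _).mpr ⟨h0, a, rfl⟩
      have h1 : (algorithm Φ).state G X H (t₀ + (t + 1)) a =
          ⟨((algorithm Φ).act ((algorithm Φ).state G X H (t₀ + t) a).loc
            (Fin.ofNat _ (t₀ + t), ((algorithm Φ).state G X H t₀ a).loc,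
              p.know G X S (t + 1) ((algorithm Φ).state G X H t₀ a).loc)).2,
          ((algorithm Φ).act ((algorithm Φ).state G X H (t₀ + t) a).loc
            (Fin.ofNat _ (t₀ + t), ((algorithm Φ).state G X H t₀ a).loc,
              p.know G X S (t + 1) ((algorithm Φ).state G X H t₀ a).loc)).1⟩ := by
        rw [← add_assoc, state_succ]
        simp only [DistributedAlgorithm.step, if_neg haX]
        have hround : ((algorithm Φ).round G X H)^[(algorithm Φ).rounds]
            ((algorithm Φ).state G X H (t₀ + t)) a =
            ⟨((algorithm Φ).state G X H (t₀ + t) a).loc,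
            (Fin.ofNat _ (t₀ + t), ((algorithm Φ).state G X H t₀ a).loc,
              p.know G X S (t + 1) ((algorithm Φ).state G X H t₀ a).loc)⟩ := by
          change (algorithm Φ).round G X H ((algorithm Φ).state G X H (t₀ + t)) a = _
          unfold DistributedAlgorithm.round
          congr 1
          rw [hmem a haX]
          change (_, _, _ ∪ _) = _
          simp only [Phase.know]
          congr 3
          ext x
          simp only [Finset.mem_biUnion, Finset.mem_univ, true_and, Finset.mem_filter]
          constructor
          · rintro ⟨v, hv⟩
            simp only [DistributedAlgorithm.inbox] at hv
            split_ifs at hv with h3 h4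
            · obtain ⟨h5, h6, h7⟩ := h4
              have h8 := (ih ⟨v, h3⟩).2 (absorb _ h6)
              refine ⟨((algorithm Φ).state G X H t₀ ⟨v, h3⟩).loc, ⟨?_, ?_, ?_, ?_⟩, ?_⟩
              · exact (hc.mem_iff _).mpr ⟨absorb _ h6, _, rfl⟩
              · exact hc.inj _ _ h5 (absorb _ h6) h0
              · rw [← h8.1]; exact h6
              · rw [← h8.1, ← h2]; exact h7
              · rw [hmem _ h6] at hv
                exact hv
            · exact absurd hv (Finset.notMem_empty x)
            · exact absurd hv (Finset.notMem_empty x)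
          · rintro ⟨w, ⟨hw, h3, h4, h5⟩, hx⟩
            obtain ⟨hwX, b, rfl⟩ := (hc.mem_iff w).mp hw
            have h6 := (ih b).2 hwX
            refine ⟨b, ?_⟩
            have h7 : ((algorithm Φ).state G X H (t₀ + t) b).loc ∉ X := h6.1 ▸ h4
            have h8 : b ≠ a := fun h => h3 (by rw [h])
            simp only [DistributedAlgorithm.inbox]
            rw [dif_pos b.2, if_pos ⟨h8, h7, by rw [h2, h6.1]; exact h5⟩, hmem b h7]
            exact hx
        rw [hround]
      rw [h1, algorithm_act (by omega) (hloc t (by omega)), hp.loc _ hS t (by omega) (h2 ▸ haX)]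
      refine ⟨rfl, fun _ => ?_⟩
      rw [add_assoc]

/-- In step `t + 1` all agents present make admissible moves without collisions. -/
def GoodStep (G : SimpleGraph V) (X H : Finset V) (loc : H → ℕ → V) (t : ℕ) : Prop :=
  (∀ a, loc a t ∉ X → loc a (t + 1) = loc a t ∨ G.Adj (loc a t) (loc a (t + 1))) ∧
  ∀ a b, a ≠ b → loc a t ∉ X → loc b t ∉ X → loc a (t + 1) ≠ loc b (t + 1)

theorem goodStep_of_isClean {t₀ : ℕ} {S : Finset V} (hc : IsClean G X Φ H t₀ S) {p : Phase V}
    (hp : p.Ok G X S) (hle : t₀ + p.dur ≤ total Φ)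
    (hloc : ∀ t < p.dur, locate Φ (t₀ + t) = some (p, t)) {t : ℕ} (ht : t < p.dur) :
    GoodStep G X H ((algorithm Φ).run G X H) (t₀ + t) := by
  have hst := state_of_isClean hc hp hle hloc
  have h0 : ∀ a, ((algorithm Φ).state G X H (t₀ + t) a).loc ∉ X →
      ((algorithm Φ).state G X H t₀ a).loc ∉ X := fun a ha h => ha (by
    rw [(hst t ht.le a).1 h]; exact h)
  have hS : ∀ a, ((algorithm Φ).state G X H t₀ a).loc ∉ X →
      ((algorithm Φ).state G X H t₀ a).loc ∈ S := fun a ha => (hc.mem_iff _).mpr ⟨ha, a, rfl⟩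
  unfold GoodStep DistributedAlgorithm.run
  constructor
  · intro a ha
    have h1 := h0 a ha
    rw [add_assoc, ((hst (t + 1) ht a).2 h1).1, ((hst t ht.le a).2 h1).1]
    exact hp.sched.move _ (hS a h1) t ht
  · intro a b hab ha hb
    have h1 := h0 a ha
    have h2 := h0 b hb
    rw [((hst t ht.le a).2 h1).1] at ha
    rw [((hst t ht.le b).2 h2).1] at hb
    rw [add_assoc, ((hst (t + 1) ht a).2 h1).1, ((hst (t + 1) ht b).2 h2).1]
    exact hp.sched.coll _ (hS a h1) _ (hS b h2) (hc.inj a b hab h1 h2) t ht ha hb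

theorem IsClean.next {t₀ : ℕ} {S : Finset V} (hc : IsClean G X Φ H t₀ S) {p : Phase V}
    (hp : p.Ok G X S) (hle : t₀ + p.dur ≤ total Φ)
    (hloc : ∀ t < p.dur, locate Φ (t₀ + t) = some (p, t)) :
    IsClean G X Φ H (t₀ + p.dur) (p.next X S) := by
  have hst := state_of_isClean hc hp hle hloc p.dur le_rfl
  have h0 : ∀ a, ((algorithm Φ).state G X H (t₀ + p.dur) a).loc ∉ X →
      ((algorithm Φ).state G X H t₀ a).loc ∉ X := fun a ha h => ha (by
    rw [(hst a).1 h]; exact h)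
  refine ⟨hle, ?_, ?_, ?_⟩
  · intro a ha
    have h1 := (hst a).2 (h0 a ha)
    rw [h1.2 (h1.1 ▸ ha), if_pos rfl, h1.1]
  · intro a b hab ha hb
    by_cases hd : p.dur = 0
    · rw [hd, add_zero] at ha hb ⊢
      exact hc.inj a b hab ha hb
    · obtain ⟨d, hd⟩ : ∃ d, p.dur = d + 1 := ⟨p.dur - 1, by omega⟩
      have habs : ∀ c, ((algorithm Φ).state G X H (t₀ + p.dur) c).loc ∉ X →
          ((algorithm Φ).state G X H (t₀ + d) c).loc ∉ X := by
        intro c hcX h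
        apply hcX
        rw [hd, ← add_assoc, state_succ]
        simpa only [DistributedAlgorithm.step, if_pos h] using h
      have h3 := (goodStep_of_isClean hc hp hle hloc (t := d) (by omega)).2 a b hab (habs a ha)
        (habs b hb)
      rw [add_assoc, ← hd] at h3
      exact h3
  · intro v
    simp only [Phase.next, Finset.mem_filter, Finset.mem_image]
    constructor
    · rintro ⟨⟨w, hw, rfl⟩, hX⟩
      obtain ⟨hwX, a, rfl⟩ := (hc.mem_iff w).mp hw
      exact ⟨hX, a, ((hst a).2 hwX).1⟩
    · rintro ⟨hX, a, rfl⟩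
      exact ⟨⟨_, (hc.mem_iff _).mpr ⟨h0 a hX, a, rfl⟩, (((hst a).2 (h0 a hX)).1).symm⟩, hX⟩

/-- The induction carries along the prefix `qs` already executed, which fixes the absolute time at
which the phases `ps` begin. The second part gives access to the occupied set after any initial part
of `ps`. -/
theorem goodStep_and_isClean (ps : List (Phase V)) : ∀ (qs : List (Phase V)) (S : Finset V),
    Φ = qs ++ ps → Oks G X ps S → IsClean G X Φ H (total qs) S →
    (∀ t, total qs ≤ t → t < total Φ → GoodStep G X H ((algorithm Φ).run G X H) t) ∧
    ∀ ps₁ ps₂, ps = ps₁ ++ ps₂ → IsClean G X Φ H (total qs + total ps₁) (nexts X ps₁ S) := by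
  induction ps with
  | nil =>
    intro qs S hΦ _ hc
    refine ⟨fun t h1 h2 => ?_, fun ps₁ ps₂ h => ?_⟩
    · rw [hΦ, List.append_nil] at h2
      omega
    · obtain ⟨rfl, rfl⟩ := List.append_eq_nil_iff.mp h.symm
      exact hc
  | cons p ps ih =>
    intro qs S hΦ hok hc
    have hloc : ∀ t < p.dur, locate Φ (total qs + t) = some (p, t) := fun t ht => by
      rw [hΦ]; exact locate_append qs p ps ht
    have hle : total qs + p.dur ≤ total Φ := by
      rw [hΦ, total_append, total_cons]; omega
    have htot : total (qs ++ [p]) = total qs + p.dur := by simp [total]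
    obtain ⟨ih1, ih2⟩ := ih (qs ++ [p]) (p.next X S) (by rw [hΦ]; simp) hok.2
      (by rw [htot]; exact hc.next hok.1 hle hloc)
    refine ⟨fun t h1 h2 => ?_, fun ps₁ ps₂ h => ?_⟩
    · by_cases ht : t < total qs + p.dur
      · obtain ⟨u, rfl⟩ : ∃ u, t = total qs + u := ⟨t - total qs, by omega⟩
        exact goodStep_of_isClean hc hok.1 hle hloc (by omega)
      · exact ih1 t (by omega) h2
    · cases ps₁ with
      | nil => exact hc
      | cons p' ps₁ =>
        rw [List.cons_append, List.cons.injEq] at h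
        obtain ⟨rfl, h⟩ := h
        have := ih2 ps₁ ps₂ h
        rw [htot] at this
        rw [total_cons, ← add_assoc]
        exact this

/-- If the phases can be carried out and an initial part of them evacuates all agents, then the
algorithm produces an evacuation strategy. -/
theorem exists_isStrategyOfLength (hHX : Disjoint H X) (ps₁ ps₂ : List (Phase V))
    (hΦ : Φ = ps₁ ++ ps₂) (hok : Oks G X Φ H) (hempty : nexts X ps₁ H = ∅) :
    ∃ ℓ, IsStrategyOfLength G X H ((algorithm Φ).run G X H) ℓ ∧ ℓ ≤ total ps₁ := by
  classical
  obtain ⟨hgood, hclean⟩ := goodStep_and_isClean (G := G) (X := X) (Φ := Φ) (H := H) Φ [] H rfl hok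
    (isClean_zero G X Φ H hHX)
  have hc := hclean ps₁ ps₂ hΦ
  rw [hempty] at hc
  have htot : total ([] : List (Phase V)) + total ps₁ = total ps₁ := by simp [total]
  rw [htot] at hc
  have hex : ∀ a : H, ∃ t, t ≤ total ps₁ ∧ (algorithm Φ).run G X H a t ∈ X := by
    intro a
    refine ⟨_, le_rfl, ?_⟩
    by_contra h
    exact Finset.notMem_empty _ ((hc.mem_iff _).mpr ⟨h, a, rfl⟩)
  let s : H → ℕ := fun a => Nat.find (hex a)
  have hs : ∀ a, s a ≤ total ps₁ := fun a => (Nat.find_spec (hex a)).1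
  have hfirst : ∀ a, ∀ t < s a, (algorithm Φ).run G X H a t ∉ X :=
    fun a t ht h => Nat.find_min (hex a) ht ⟨(ht.trans_le (hs a)).le, h⟩
  have hgood : ∀ t < total ps₁, GoodStep G X H ((algorithm Φ).run G X H) t := fun t ht =>
    hgood t (by simp [total]) (ht.trans_le hc.le)
  refine ⟨_, ⟨s, ⟨fun a => rfl, ?_, fun a => (Nat.find_spec (hex a)).2, hfirst, ?_⟩, rfl⟩,
    Finset.sup_le fun a _ => hs a⟩
  · intro a t ht
    exact (hgood t (ht.trans_le (hs a))).1 a (hfirst a t ht)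
  · intro a b hab t h1 h2
    obtain ⟨t, rfl⟩ : ∃ u, t = u + 1 := ⟨t - 1, by omega⟩
    have h3 : t < s a := by omega
    have h4 : t < s b := by omega
    exact (hgood t (h3.trans_le (hs a))).2 a b hab (hfirst a t h3) (hfirst b t h4)
end

/-! ### Walking to visible exits -/

/-- A direction of movement along disjoint lines of length at most `W`: `ahead v w` says that `w` lies
ahead of `v` on the same line, and `next v` is the neighbour of `v` in this direction. -/
structure Direction {V : Type} (G : SimpleGraph V) (W : ℕ) where
  ahead : V → V → Prop
  next : V → V
  gap : V → V → ℕ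
  adj : ∀ v w, ahead v w → G.Adj v (next v)
  ahead_next : ∀ v w, ahead v w → next v = w ∨ ahead (next v) w
  next_inj : ∀ v w v' w', ahead v w → ahead v' w' → next v = next v' → v = v'
  gap_le : ∀ v w, ahead v w → gap v w ≤ W
  gap_next : ∀ v w, ahead v w → gap (next v) w < gap v w

namespace Direction
variable {V : Type} {G : SimpleGraph V} {W : ℕ} (δ : Direction G W) (X : Finset V)

open Classical in
/-- Agents with an exit ahead advance by one step. -/
noncomputable def advance (v : V) : V := if v ∉ X ∧ ∃ w ∈ X, δ.ahead v w then δ.next v else v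

/-- The phase in which all agents with an exit ahead walk to it. -/
noncomputable def flush : Phase V where
  dur := W
  traj _ v t := (δ.advance X)^[t] v

variable {X}

theorem advance_of_mem {v : V} (hv : v ∈ X) : δ.advance X v = v := by
  simp [advance, hv]

/-- An agent can only move onto a vertex that is an exit or itself has the exit ahead; in the latter
case the agent there moves on as well. -/
theorem advance_injOn {v w : V} (hv : v ∉ X) (hw : w ∉ X) (h : δ.advance X v = δ.advance X w) :
    v = w := by
  unfold advance at h
  have key : ∀ {v w x : V}, w ∉ X → (¬ ∃ y ∈ X, δ.ahead w y) → x ∈ X → δ.ahead v x →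
      δ.next v = w → False := by
    intro v w x hw hn hx hvx hvw
    rcases δ.ahead_next v x hvx with h1 | h1
    · exact hw (by rw [← hvw, h1]; exact hx)
    · exact hn ⟨x, hx, by rw [← hvw]; exact h1⟩
  split_ifs at h with h1 h2 h2
  · obtain ⟨-, x, -, hx⟩ := h1
    obtain ⟨-, y, -, hy⟩ := h2
    exact δ.next_inj v x w y hx hy h
  · obtain ⟨-, x, hxX, hx⟩ := h1
    exact (key hw (fun hn => h2 ⟨hw, hn⟩) hxX hx h).elim
  · obtain ⟨-, x, hxX, hx⟩ := h2
    exact (key hv (fun hn => h1 ⟨hv, hn⟩) hxX hx h.symm).elim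
  · exact h

theorem advance_eq_or_adj (v : V) : δ.advance X v = v ∨ G.Adj v (δ.advance X v) := by
  unfold advance
  split_ifs with h
  · obtain ⟨-, x, -, hx⟩ := h
    exact Or.inr (δ.adj v x hx)
  · exact Or.inl rfl

theorem iterate_advance_of_not {v : V} (hv : ¬ ∃ w ∈ X, δ.ahead v w) (t : ℕ) :
    (δ.advance X)^[t] v = v := by
  apply Function.iterate_fixed
  unfold advance
  rw [if_neg (fun h => hv h.2)]

theorem iterate_advance_mem {v : V} (hv : ∃ w ∈ X, δ.ahead v w) :
    (δ.advance X)^[W] v ∈ X := by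
  have key : ∀ t, (δ.advance X)^[t] v ∈ X ∨ ∃ w ∈ X, δ.ahead ((δ.advance X)^[t] v) w ∧
      δ.gap ((δ.advance X)^[t] v) w + t ≤ W := by
    intro t
    induction t with
    | zero =>
      obtain ⟨w, hw, h⟩ := hv
      exact Or.inr ⟨w, hw, h, δ.gap_le v w h⟩
    | succ t ih =>
      rw [Function.iterate_succ_apply']
      by_cases hX : (δ.advance X)^[t] v ∈ X
      · left; rw [advance_of_mem δ hX]; exact hX
      rcases ih with ih | ⟨w, hw, h1, h2⟩
      · exact absurd ih hX
      · have h3 : δ.advance X ((δ.advance X)^[t] v) = δ.next ((δ.advance X)^[t] v) := by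
          conv_lhs => unfold advance
          rw [if_pos ⟨hX, w, hw, h1⟩]
          rfl
        rw [h3]
        rcases δ.ahead_next _ w h1 with h4 | h4
        · left; rw [h4]; exact hw
        · have := δ.gap_next _ w h1
          exact Or.inr ⟨w, hw, h4, by omega⟩
  rcases key W with h | ⟨w, hw, h1, h2⟩
  · exact h
  · have := δ.gap_next _ w h1
    omega

theorem flush_ok [DecidableEq V] (S : Finset V) : (δ.flush X).Ok G X S where
  sched :=
    { start := fun v _ => rfl
      move := fun v _ t _ => by
        simp only [flush, Function.iterate_succ_apply']
        exact δ.advance_eq_or_adj _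
      absorb := fun v _ t _ h => by
        simp only [flush, Function.iterate_succ_apply'] at h ⊢
        exact δ.advance_of_mem h
      coll := by
        intro v _ w _ hne t _ hv hw
        simp only [flush, Function.iterate_succ_apply'] at hv hw ⊢
        intro h
        have key : ∀ t, (δ.advance X)^[t] v ∉ X → (δ.advance X)^[t] w ∉ X →
            (δ.advance X)^[t] v ≠ (δ.advance X)^[t] w := by
          intro t
          induction t with
          | zero => intro _ _; exact hne
          | succ t ih =>
            simp only [Function.iterate_succ_apply']
            intro h1 h2 h3
            have h1' : (δ.advance X)^[t] v ∉ X := fun h => h1 (by rwa [δ.advance_of_mem h])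
            have h2' : (δ.advance X)^[t] w ∉ X := fun h => h2 (by rwa [δ.advance_of_mem h])
            exact ih h1' h2' (δ.advance_injOn h1' h2' h3)
        exact key t hv hw (δ.advance_injOn hv hw h)
      final := fun v hv => by
        by_cases h : ∃ w ∈ X, δ.ahead v w
        · exact Or.inl (δ.iterate_advance_mem h)
        · right
          simp only [flush, δ.iterate_advance_of_not h]
          exact hv }
  -- No communication is needed: the trajectory does not depend on the other agents.
  loc := fun _ _ _ _ _ => rfl

theorem mem_next_flush [DecidableEq V] {S : Finset V} {v : V} (hv : v ∈ (δ.flush X).next X S) :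
    v ∈ S ∧ ∀ w ∈ X, ¬ δ.ahead v w := by
  simp only [Phase.next, Finset.mem_filter, Finset.mem_image] at hv
  obtain ⟨⟨u, hu, rfl⟩, hX⟩ := hv
  by_cases h : ∃ w ∈ X, δ.ahead u w
  · exact absurd (δ.iterate_advance_mem h) hX
  · have h1 : (δ.flush X).traj S u (δ.flush X).dur = u := δ.iterate_advance_of_not h _
    rw [h1]
    push Not at h
    exact ⟨hu, h⟩

end Direction

/-! ### The four directions in a tiled grid -/

theorem eq_or_adj_of_close {m n : ℕ} {u v : Fin m × Fin n}
    (h : (u.1.val = v.1.val ∧ u.2.val ≤ v.2.val + 1 ∧ v.2.val ≤ u.2.val + 1) ∨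
      (u.2.val = v.2.val ∧ u.1.val ≤ v.1.val + 1 ∧ v.1.val ≤ u.1.val + 1)) :
    v = u ∨ (gridGraph m n).Adj u v := by
  rw [gridGraph_adj, Prod.ext_iff, Fin.ext_iff, Fin.ext_iff]
  rcases abs_cases ((u.1.val : ℤ) - (v.1.val : ℤ)) with h1 | h1 <;>
    rcases abs_cases ((u.2.val : ℤ) - (v.2.val : ℤ)) with h2 | h2 <;> omega

theorem adj_of_close {m n : ℕ} {u v : Fin m × Fin n}
    (h : (u.1.val = v.1.val ∧ (u.2.val = v.2.val + 1 ∨ v.2.val = u.2.val + 1)) ∨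
      (u.2.val = v.2.val ∧ (u.1.val = v.1.val + 1 ∨ v.1.val = u.1.val + 1))) :
    (gridGraph m n).Adj u v := by
  rw [gridGraph_adj]
  rcases abs_cases ((u.1.val : ℤ) - (v.1.val : ℤ)) with h1 | h1 <;>
    rcases abs_cases ((u.2.val : ℤ) - (v.2.val : ℤ)) with h2 | h2 <;> omega

section grid
variable {m n W : ℕ} (π₁ : IntervalPartition m W) (π₂ : IntervalPartition n W)

theorem IntervalPartition.lo_of_between {m W : ℕ} (π : IntervalPartition m W) {i i' j : ℕ}
    (hi : i < m) (hi' : i' < m) (h : π.lo i = π.lo i') (h1 : i ≤ j) (h2 : j ≤ i') :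
    π.lo j = π.lo i ∧ i' < i + W := by
  have h3 := π.lo_le i hi
  have h4 := π.lt_add i' hi'
  have h5 := π.len_le i hi
  rw [← h, ← π.len_eq hi hi' h] at h4
  exact ⟨(π.eq_of_mem i hi j (by omega) (by omega)).1, by omega⟩

/-- Towards smaller second coordinates. -/
def leftward : Direction (gridGraph m n) W where
  ahead v w := v.1 = w.1 ∧ w.2.val < v.2.val ∧ π₂.lo v.2 = π₂.lo w.2
  next v := (v.1, ⟨v.2.val - 1, by omega⟩)
  gap v w := v.2.val - w.2.val
  adj := by
    rintro v w ⟨h1, h2, h3⟩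
    exact adj_of_close (Or.inl ⟨rfl, by simp only; omega⟩)
  ahead_next := by
    rintro v w ⟨h1, h2, h3⟩
    by_cases h : w.2.val + 1 = v.2.val
    · left; exact Prod.ext h1 (Fin.ext (by simp only; omega))
    · right
      refine ⟨h1, by simp only; omega, ?_⟩
      exact (π₂.lo_of_between w.2.2 v.2.2 h3.symm (by simp only; omega) (by simp only; omega)).1
  next_inj := by
    rintro v w v' w' ⟨h1, h2, h3⟩ ⟨h1', h2', h3'⟩ h
    simp only [Prod.mk.injEq, Fin.mk.injEq] at h
    exact Prod.ext h.1 (Fin.ext (by omega))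
  gap_le := by
    rintro v w ⟨h1, h2, h3⟩
    have := (π₂.lo_of_between w.2.2 v.2.2 h3.symm le_rfl h2.le).2
    omega
  gap_next := by
    rintro v w ⟨h1, h2, h3⟩
    simp only
    omega

/-- Towards larger second coordinates. -/
def rightward : Direction (gridGraph m n) W where
  ahead v w := v.1 = w.1 ∧ v.2.val < w.2.val ∧ π₂.lo v.2 = π₂.lo w.2
  -- The minimum only makes the function total; it has no effect when some vertex lies ahead.
  next v := (v.1, ⟨min (v.2.val + 1) (n - 1), by omega⟩)
  gap v w := w.2.val - v.2.val
  adj := by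
    rintro v w ⟨h1, h2, h3⟩
    exact adj_of_close (Or.inl ⟨rfl, by simp only; omega⟩)
  ahead_next := by
    rintro v w ⟨h1, h2, h3⟩
    by_cases h : v.2.val + 1 = w.2.val
    · left; exact Prod.ext h1 (Fin.ext (by simp only; omega))
    · right
      refine ⟨h1, by simp only; omega, ?_⟩
      rw [← h3]
      exact (π₂.lo_of_between v.2.2 w.2.2 h3 (by simp only; omega) (by simp only; omega)).1
  next_inj := by
    rintro v w v' w' ⟨h1, h2, h3⟩ ⟨h1', h2', h3'⟩ h
    simp only [Prod.mk.injEq, Fin.mk.injEq] at h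
    exact Prod.ext h.1 (Fin.ext (by omega))
  gap_le := by
    rintro v w ⟨h1, h2, h3⟩
    have := (π₂.lo_of_between v.2.2 w.2.2 h3 le_rfl h2.le).2
    omega
  gap_next := by
    rintro v w ⟨h1, h2, h3⟩
    simp only
    omega

/-- Towards smaller first coordinates. -/
def upward : Direction (gridGraph m n) W where
  ahead v w := v.2 = w.2 ∧ w.1.val < v.1.val ∧ π₁.lo v.1 = π₁.lo w.1
  next v := (⟨v.1.val - 1, by omega⟩, v.2)
  gap v w := v.1.val - w.1.val
  adj := by
    rintro v w ⟨h1, h2, h3⟩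
    exact adj_of_close (Or.inr ⟨rfl, by simp only; omega⟩)
  ahead_next := by
    rintro v w ⟨h1, h2, h3⟩
    by_cases h : w.1.val + 1 = v.1.val
    · left; exact Prod.ext (Fin.ext (by simp only; omega)) h1
    · right
      refine ⟨h1, by simp only; omega, ?_⟩
      exact (π₁.lo_of_between w.1.2 v.1.2 h3.symm (by simp only; omega) (by simp only; omega)).1
  next_inj := by
    rintro v w v' w' ⟨h1, h2, h3⟩ ⟨h1', h2', h3'⟩ h
    simp only [Prod.mk.injEq, Fin.mk.injEq] at h
    exact Prod.ext (Fin.ext (by omega)) h.2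
  gap_le := by
    rintro v w ⟨h1, h2, h3⟩
    have := (π₁.lo_of_between w.1.2 v.1.2 h3.symm le_rfl h2.le).2
    omega
  gap_next := by
    rintro v w ⟨h1, h2, h3⟩
    simp only
    omega

/-- Towards larger first coordinates. -/
def downward : Direction (gridGraph m n) W where
  ahead v w := v.2 = w.2 ∧ v.1.val < w.1.val ∧ π₁.lo v.1 = π₁.lo w.1
  next v := (⟨min (v.1.val + 1) (m - 1), by omega⟩, v.2)
  gap v w := w.1.val - v.1.val
  adj := by
    rintro v w ⟨h1, h2, h3⟩
    exact adj_of_close (Or.inr ⟨rfl, by simp only; omega⟩)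
  ahead_next := by
    rintro v w ⟨h1, h2, h3⟩
    by_cases h : v.1.val + 1 = w.1.val
    · left; exact Prod.ext (Fin.ext (by simp only; omega)) h1
    · right
      refine ⟨h1, by simp only; omega, ?_⟩
      rw [← h3]
      exact (π₁.lo_of_between v.1.2 w.1.2 h3 (by simp only; omega) (by simp only; omega)).1
  next_inj := by
    rintro v w v' w' ⟨h1, h2, h3⟩ ⟨h1', h2', h3'⟩ h
    simp only [Prod.mk.injEq, Fin.mk.injEq] at h
    exact Prod.ext (Fin.ext (by omega)) h.2
  gap_le := by
    rintro v w ⟨h1, h2, h3⟩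
    have := (π₁.lo_of_between v.1.2 w.1.2 h3 le_rfl h2.le).2
    omega
  gap_next := by
    rintro v w ⟨h1, h2, h3⟩
    simp only
    omega

end grid

/-! ### Spread of knowledge -/

section know
variable {V : Type} [DecidableEq V] {G : SimpleGraph V} {X : Finset V} {p : Phase V} {S : Finset V}

theorem Phase.know_subset {v : V} (hv : v ∈ S) (t : ℕ) : p.know G X S t v ⊆ S := by
  classical
  induction t generalizing v with
  | zero => simpa [Phase.know] using hv
  | succ t ih =>
    simp only [Phase.know]
    refine Finset.union_subset (ih hv) (Finset.biUnion_subset.mpr fun w hw => ih ?_)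
    exact (Finset.mem_filter.mp hw).1

theorem Phase.know_mono (v : V) : Monotone fun t => p.know G X S t v :=
  monotone_nat_of_le_succ fun t => by
    simp only [Phase.know]
    exact Finset.subset_union_left

theorem Phase.self_mem_know (v : V) (t : ℕ) : v ∈ p.know G X S t v :=
  p.know_mono v (Nat.zero_le t) (by simp [Phase.know])

theorem Phase.know_subset_know {v w : V} (hw : w ∈ S) {t : ℕ} (hX : p.traj S w t ∉ X)
    (h : G.Adj (p.traj S v t) (p.traj S w t)) :
    p.know G X S t w ⊆ p.know G X S (t + 1) v := by
  classical
  by_cases hvw : w = v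
  · subst hvw
    exact p.know_mono w (Nat.le_succ t)
  · simp only [Phase.know]
    refine subset_trans ?_ Finset.subset_union_right
    exact Finset.subset_biUnion_of_mem (fun w => p.know G X S t w)
      (Finset.mem_filter.mpr ⟨hw, hvw, hX, Or.inl h⟩)

end know

/-! ### Gathering information within tiles: motion -/

section gather
variable {m n W : ℕ} (π₁ : IntervalPartition m W) (π₂ : IntervalPartition n W)
  (X : Finset (Fin m × Fin n))

/-- `u` and `v` are in the same tile. -/
def SameTile (u v : Fin m × Fin n) : Prop := π₁.lo u.1 = π₁.lo v.1 ∧ π₂.lo u.2 = π₂.lo v.2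

instance (u v : Fin m × Fin n) : Decidable (SameTile π₁ π₂ u v) :=
  inferInstanceAs (Decidable (_ ∧ _))

/-- The column `j` of the tile with the given lower bounds contains no exit. -/
def FreeColumn (a b j : ℕ) : Prop :=
  j < n ∧ π₂.lo j = b ∧ ∀ x ∈ X, π₁.lo x.1 = a → x.2.val ≠ j

open Classical in
/-- A column of a tile without exits. -/
noncomputable def freeColumn (a b : ℕ) : ℕ :=
  if h : ∃ j, FreeColumn π₁ π₂ X a b j then h.choose else 0

/-- The free column of the tile of `v`. -/
noncomputable def center (v : Fin m × Fin n) : ℕ := freeColumn π₁ π₂ X (π₁.lo v.1) (π₂.lo v.2)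

/-- A linear order of the vertices of a row by distance from column `c`. -/
def remoteness (c j : ℕ) : ℕ := if j ≤ c then 2 * (c - j) else 2 * (j - c) - 1

/-- The agent at `v` is the closest one to the free column in its row of the tile. -/
def Leads (S : Finset (Fin m × Fin n)) (v : Fin m × Fin n) : Prop :=
  ∀ w ∈ S, SameTile π₁ π₂ w v → w.1 = v.1 →
    remoteness (center π₁ π₂ X v) v.2 ≤ remoteness (center π₁ π₂ X v) w.2

/-- The position after `t` steps from `j` towards `c`. -/
def approach (c j t : ℕ) : ℕ := if j ≤ c then min (j + t) c else max (j - t) c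

open Classical in
/-- The row of the agent starting at `v`, while information is gathered: leaders exchange it along the
free column. -/
noncomputable def rowAt (S : Finset (Fin m × Fin n)) (v : Fin m × Fin n) (t : ℕ) : ℕ :=
  -- By truncated subtraction nobody changes rows before time `3 * W`, when all leaders have reached
  -- the free column.
  if Leads π₁ π₂ X S v then π₁.swap v.1 (t - 3 * W) else v.1

open Classical in
/-- The column of the agent starting at `v`, while information is gathered: agents exchange it along
the rows and return, and then the leaders walk to the free column. -/
noncomputable def colAt (S : Finset (Fin m × Fin n)) (v : Fin m × Fin n) (t : ℕ) : ℕ :=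
  if t ≤ 2 * W then π₂.swap v.2 (min t (2 * W - t))
  else if Leads π₁ π₂ X S v then approach (center π₁ π₂ X v) v.2 (t - 2 * W) else v.2

/-- The vertex with the given coordinates, taken modulo the size of the grid. -/
def cell (v : Fin m × Fin n) (i j : ℕ) : Fin m × Fin n :=
  (⟨i % m, Nat.mod_lt _ (Nat.zero_lt_of_lt v.1.2)⟩, ⟨j % n, Nat.mod_lt _ (Nat.zero_lt_of_lt v.2.2)⟩)

/-- All agents of a tile gather information on each other and return, and then they follow a
schedule that depends on the set of agents in their tile. -/
noncomputable def gatherThen (D : ℕ)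
    (sched : Finset (Fin m × Fin n) → Fin m × Fin n → ℕ → Fin m × Fin n) : Phase (Fin m × Fin n) where
  dur := 8 * W + D
  traj S v t :=
    -- Up to time `4 * W` the rows exchange and return (`2 * W`), the leaders walk to the free
    -- column (`W`) and exchange there (`W`). Then `min t (8 * W - t)` plays the whole motion
    -- backwards.
    if t ≤ 8 * W then
      cell v (rowAt π₁ π₂ X S v (min t (8 * W - t))) (colAt π₁ π₂ X S v (min t (8 * W - t)))
    else sched (S.filter fun w => SameTile π₁ π₂ w v) v (t - 8 * W)

/-- Rows and columns of tiles that contain agents do not contain exits. -/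
def IsFree (S : Finset (Fin m × Fin n)) : Prop :=
  ∀ v ∈ S, ∀ x ∈ X, SameTile π₁ π₂ x v → x.1 ≠ v.1 ∧ x.2 ≠ v.2

variable {π₁ π₂ X} {S : Finset (Fin m × Fin n)}

theorem center_eq {u v : Fin m × Fin n} (h : SameTile π₁ π₂ u v) :
    center π₁ π₂ X u = center π₁ π₂ X v := by
  rw [center, center, h.1, h.2]

/-- The column of `v` itself is a witness. The choice depends only on the tile, so all its agents
agree on it. -/
theorem freeColumn_center (hS : IsFree π₁ π₂ X S) {v : Fin m × Fin n} (hv : v ∈ S) :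
    FreeColumn π₁ π₂ X (π₁.lo v.1) (π₂.lo v.2) (center π₁ π₂ X v) := by
  have h : ∃ j, FreeColumn π₁ π₂ X (π₁.lo v.1) (π₂.lo v.2) j :=
    ⟨v.2, v.2.2, rfl, fun x hx hlo hxv =>
      (hS v hv x hx ⟨hlo, by rw [hxv]⟩).2 (Fin.ext hxv)⟩
  rw [center, freeColumn, dif_pos h]
  exact h.choose_spec

/-- Columns up to `c` get even values and those beyond it odd ones. This breaks ties in distance, so
that each occupied row of a tile has a unique leader. -/
theorem remoteness_injective {c j j' : ℕ} (h : remoteness c j = remoteness c j') : j = j' := by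
  unfold remoteness at h
  split_ifs at h <;> omega

theorem exists_leads {v : Fin m × Fin n} (hv : v ∈ S) :
    ∃ w ∈ S, SameTile π₁ π₂ w v ∧ w.1 = v.1 ∧ Leads π₁ π₂ X S w := by
  obtain ⟨w, hw, hmin⟩ := (S.filter fun w => SameTile π₁ π₂ w v ∧ w.1 = v.1).exists_min_image
    (fun w => remoteness (center π₁ π₂ X v) w.2) ⟨v, Finset.mem_filter.mpr ⟨hv, ⟨rfl, rfl⟩, rfl⟩⟩
  obtain ⟨hwS, hwt, hw1⟩ := Finset.mem_filter.mp hw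
  refine ⟨w, hwS, hwt, hw1, fun u hu hut hu1 => ?_⟩
  rw [center_eq hwt]
  exact hmin u (Finset.mem_filter.mpr
    ⟨hu, ⟨hut.1.trans hwt.1, hut.2.trans hwt.2⟩, hu1.trans hw1⟩)

theorem Leads.eq {v w : Fin m × Fin n} (hv : v ∈ S) (hw : w ∈ S) (hvl : Leads π₁ π₂ X S v)
    (hwl : Leads π₁ π₂ X S w) (ht : SameTile π₁ π₂ w v) (h1 : w.1 = v.1) : v = w := by
  have h2 := hvl w hw ht h1
  have h3 := hwl v hv ⟨ht.1.symm, ht.2.symm⟩ h1.symm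
  rw [center_eq ht] at h3
  exact Prod.ext h1.symm (Fin.ext (remoteness_injective (le_antisymm h2 h3)))

theorem approach_bounds (c j t : ℕ) : min j c ≤ approach c j t ∧ approach c j t ≤ max j c := by
  unfold approach
  split_ifs <;> omega

theorem approach_succ (c j t : ℕ) :
    approach c j (t + 1) ≤ approach c j t + 1 ∧ approach c j t ≤ approach c j (t + 1) + 1 := by
  unfold approach
  split_ifs <;> omega

theorem approach_zero (c j : ℕ) : approach c j 0 = j := by
  unfold approach
  split_ifs <;> omega

theorem approach_of_le {c j t : ℕ} (h1 : j ≤ c + t) (h2 : c ≤ j + t) : approach c j t = c := by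
  unfold approach
  split_ifs <;> omega

/-- The free column of the tile of an agent is at distance less than `W`. -/
theorem approach_center (hS : IsFree π₁ π₂ X S) {v : Fin m × Fin n} (hv : v ∈ S) {t : ℕ}
    (ht : W ≤ t) : approach (center π₁ π₂ X v) v.2 t = center π₁ π₂ X v := by
  obtain ⟨h1, h2, -⟩ := freeColumn_center hS hv
  have h3 := π₂.lo_le _ h1
  have h4 := π₂.lt_add _ h1
  have h5 := π₂.lo_le _ v.2.2
  have h6 := π₂.lt_add _ v.2.2
  have h7 := π₂.len_le _ v.2.2
  have h8 := π₂.len_eq h1 v.2.2 h2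
  exact approach_of_le (by omega) (by omega)

theorem rowAt_of_le (S : Finset (Fin m × Fin n)) (v : Fin m × Fin n) {t : ℕ} (ht : t ≤ 3 * W) :
    rowAt π₁ π₂ X S v t = v.1 := by
  unfold rowAt
  rw [Nat.sub_eq_zero_of_le ht, π₁.swap_zero v.1.2, ite_self]

theorem rowAt_lt (S : Finset (Fin m × Fin n)) (v : Fin m × Fin n) (t : ℕ) :
    rowAt π₁ π₂ X S v t < m := by
  unfold rowAt
  split_ifs
  · exact π₁.swap_lt v.1.2 _
  · exact v.1.2

theorem lo_rowAt (S : Finset (Fin m × Fin n)) (v : Fin m × Fin n) (t : ℕ) :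
    π₁.lo (rowAt π₁ π₂ X S v t) = π₁.lo v.1 := by
  unfold rowAt
  split_ifs
  · exact π₁.lo_swap v.1.2 _
  · rfl

theorem colAt_lt_and_lo (hS : IsFree π₁ π₂ X S) {v : Fin m × Fin n} (hv : v ∈ S) (t : ℕ) :
    colAt π₁ π₂ X S v t < n ∧ π₂.lo (colAt π₁ π₂ X S v t) = π₂.lo v.2 := by
  unfold colAt
  split_ifs
  · exact ⟨π₂.swap_lt v.2.2 _, π₂.lo_swap v.2.2 _⟩
  · obtain ⟨h1, h2, -⟩ := freeColumn_center hS hv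
    have h3 := approach_bounds (center π₁ π₂ X v) v.2 (t - 2 * W)
    rcases le_total (v.2 : ℕ) (center π₁ π₂ X v) with h | h
    · rw [min_eq_left h, max_eq_right h] at h3
      have := (π₂.lo_of_between v.2.2 h1 h2.symm h3.1 h3.2).1
      exact ⟨by omega, this⟩
    · rw [min_eq_right h, max_eq_left h] at h3
      have := (π₂.lo_of_between h1 v.2.2 h2 h3.1 h3.2).1
      exact ⟨by omega, this.trans h2⟩
  · exact ⟨v.2.2, rfl⟩

/-- Leaders change rows only in the free column. Since this column and all occupied rows are free of
exits, no agent meets an exit while gathering. -/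
theorem rowAt_eq_or_colAt_eq (hS : IsFree π₁ π₂ X S) {v : Fin m × Fin n} (hv : v ∈ S) {t : ℕ} :
    rowAt π₁ π₂ X S v t = v.1 ∨ colAt π₁ π₂ X S v t = center π₁ π₂ X v := by
  by_cases hl : Leads π₁ π₂ X S v
  · by_cases ht : t ≤ 3 * W
    · exact Or.inl (rowAt_of_le S v ht)
    · right
      rw [colAt, if_neg (by omega), if_pos hl, approach_center hS hv (by omega)]
  · left
    rw [rowAt, if_neg hl]

theorem gather_notMem (hS : IsFree π₁ π₂ X S) {v : Fin m × Fin n} (hv : v ∈ S)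
    {u : Fin m × Fin n} {t : ℕ} (h1 : u.1.val = rowAt π₁ π₂ X S v t)
    (h2 : u.2.val = colAt π₁ π₂ X S v t) : u ∉ X := by
  intro hu
  have h3 := lo_rowAt (π₁ := π₁) (π₂ := π₂) (X := X) S v t
  have h4 := (colAt_lt_and_lo hS hv t).2
  rw [← h1] at h3
  rw [← h2] at h4
  rcases rowAt_eq_or_colAt_eq hS hv (t := t) with h | h
  · exact (hS v hv u hu ⟨h3, h4⟩).1 (Fin.ext (h1.trans h))
  · exact (freeColumn_center hS hv).2.2 u hu h3 (h2.trans h)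

theorem gather_succ (hS : IsFree π₁ π₂ X S) {v : Fin m × Fin n} (hv : v ∈ S) (t : ℕ) :
    (rowAt π₁ π₂ X S v t = rowAt π₁ π₂ X S v (t + 1) ∧
      colAt π₁ π₂ X S v t ≤ colAt π₁ π₂ X S v (t + 1) + 1 ∧
      colAt π₁ π₂ X S v (t + 1) ≤ colAt π₁ π₂ X S v t + 1) ∨
    (colAt π₁ π₂ X S v t = colAt π₁ π₂ X S v (t + 1) ∧
      rowAt π₁ π₂ X S v t ≤ rowAt π₁ π₂ X S v (t + 1) + 1 ∧
      rowAt π₁ π₂ X S v (t + 1) ≤ rowAt π₁ π₂ X S v t + 1) := by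
  by_cases ht : t + 1 ≤ 3 * W
  · left
    rw [rowAt_of_le S v ht, rowAt_of_le S v (by omega)]
    refine ⟨rfl, ?_⟩
    unfold colAt
    by_cases h1 : t + 1 ≤ 2 * W
    · rw [if_pos h1, if_pos (by omega)]
      by_cases h2 : t + 1 ≤ W
      · rw [min_eq_left (by omega), min_eq_left (by omega)]
        exact (π₂.swap_succ v.2.2 t).symm
      · rw [min_eq_right (by omega), min_eq_right (by omega),
          show 2 * W - t = 2 * W - (t + 1) + 1 by omega]
        exact π₂.swap_succ v.2.2 _
    · rw [if_neg h1]
      by_cases h2 : t = 2 * W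
      · subst h2
        rw [if_pos le_rfl, Nat.sub_self, min_eq_right (Nat.zero_le _), π₂.swap_zero v.2.2]
        split_ifs
        · have := approach_succ (center π₁ π₂ X v) v.2 0
          rw [approach_zero] at this
          rw [show 2 * W + 1 - 2 * W = 0 + 1 by omega]
          exact this.symm
        · omega
      · rw [if_neg (by omega), show t + 1 - 2 * W = t - 2 * W + 1 by omega]
        split_ifs
        · exact (approach_succ _ _ _).symm
        · omega
  · right
    unfold colAt rowAt
    have := π₁.len_le v.1 v.1.2
    have h3 := π₁.lt_add v.1 v.1.2
    have h4 := π₁.lo_le v.1 v.1.2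
    rw [if_neg (show ¬ t ≤ 2 * W by omega), if_neg (show ¬ t + 1 ≤ 2 * W by omega)]
    split_ifs
    · rw [approach_center hS hv (by omega), approach_center hS hv (by omega),
        show t + 1 - 3 * W = t - 3 * W + 1 by omega]
      exact ⟨rfl, (π₁.swap_succ v.1.2 _).symm⟩
    · omega

/-- Up to time `2 * W` the transposition networks of the rows are collision-free. Afterwards the
others rest at home: a leader on its way has nobody between itself and the free column, and no
non-leader rests in that column. -/
theorem gather_injective (hS : IsFree π₁ π₂ X S) {v w : Fin m × Fin n} (hv : v ∈ S) (hw : w ∈ S)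
    {t : ℕ} (h1 : rowAt π₁ π₂ X S v t = rowAt π₁ π₂ X S w t)
    (h2 : colAt π₁ π₂ X S v t = colAt π₁ π₂ X S w t) : v = w := by
  have htile : SameTile π₁ π₂ v w := by
    constructor
    · rw [← lo_rowAt (π₁ := π₁) (π₂ := π₂) (X := X) S v t, h1, lo_rowAt]
    · rw [← (colAt_lt_and_lo hS hv t).2, h2, (colAt_lt_and_lo hS hw t).2]
  have htile' : SameTile π₁ π₂ w v := ⟨htile.1.symm, htile.2.symm⟩
  -- a leader cannot be at the position of another agent
  have key : ∀ {v w : Fin m × Fin n}, v ∈ S → w ∈ S → 2 * W < t → SameTile π₁ π₂ v w →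
      rowAt π₁ π₂ X S v t = rowAt π₁ π₂ X S w t → colAt π₁ π₂ X S v t = colAt π₁ π₂ X S w t →
      Leads π₁ π₂ X S v → ¬ Leads π₁ π₂ X S w → False := by
    intro v w hv hw ht htile h1 h2 hvl hwl
    have hc := center_eq (X := X) htile
    rw [colAt, if_neg (by omega), if_pos hvl, colAt, if_neg (by omega), if_neg hwl] at h2
    by_cases ht3 : t ≤ 3 * W
    · rw [rowAt_of_le S v ht3, rowAt_of_le S w ht3] at h1
      have h3 := hvl w hw ⟨htile.1.symm, htile.2.symm⟩ (Fin.ext h1.symm)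
      have h5 : v.2.val = w.2.val := by
        unfold remoteness at h3
        unfold approach at h2
        split_ifs at h3 h2 <;> omega
      rw [Prod.ext (Fin.ext h1) (Fin.ext h5)] at hvl
      exact hwl hvl
    · rw [approach_center hS hv (by omega)] at h2
      refine hwl fun u _ _ _ => ?_
      rw [← hc, ← h2]
      simp [remoteness]
  by_cases ht : t ≤ 2 * W
  · rw [rowAt_of_le S v (by omega), rowAt_of_le S w (by omega)] at h1
    rw [colAt, if_pos ht, colAt, if_pos ht] at h2
    exact Prod.ext (Fin.ext h1) (Fin.ext (π₂.swap_injective v.2.2 w.2.2 h2))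
  · by_cases hvl : Leads π₁ π₂ X S v
    · by_cases hwl : Leads π₁ π₂ X S w
      · rw [rowAt, if_pos hvl, rowAt, if_pos hwl] at h1
        have h3 := π₁.swap_injective v.1.2 w.1.2 h1
        exact hvl.eq hv hw hwl htile' (Fin.ext h3.symm)
      · exact (key hv hw (by omega) htile h1 h2 hvl hwl).elim
    · by_cases hwl : Leads π₁ π₂ X S w
      · exact (key hw hv (by omega) htile' h1.symm h2.symm hwl hvl).elim
      · rw [rowAt, if_neg hvl, rowAt, if_neg hwl] at h1
        rw [colAt, if_neg ht, if_neg hvl, colAt, if_neg ht, if_neg hwl] at h2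
        exact Prod.ext (Fin.ext h1) (Fin.ext h2)

end gather

/-! ### Gathering information within tiles: knowledge and correctness -/

section
variable {m n W : ℕ} {π₁ : IntervalPartition m W} {π₂ : IntervalPartition n W}
  {X : Finset (Fin m × Fin n)} {S : Finset (Fin m × Fin n)} {D : ℕ}
  {sched : Finset (Fin m × Fin n) → Fin m × Fin n → ℕ → Fin m × Fin n}

theorem SameTile.symm {u v : Fin m × Fin n} (h : SameTile π₁ π₂ u v) : SameTile π₁ π₂ v u :=
  ⟨h.1.symm, h.2.symm⟩

theorem SameTile.trans {u v w : Fin m × Fin n} (h : SameTile π₁ π₂ u v) (h' : SameTile π₁ π₂ v w) :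
    SameTile π₁ π₂ u w :=
  ⟨h.1.trans h'.1, h.2.trans h'.2⟩

theorem gatherThen_coords (hS : IsFree π₁ π₂ X S) {v : Fin m × Fin n} (hv : v ∈ S) {t u : ℕ}
    (ht : t ≤ 8 * W) (hu : min t (8 * W - t) = u) :
    ((gatherThen π₁ π₂ X D sched).traj S v t).1.val = rowAt π₁ π₂ X S v u ∧
    ((gatherThen π₁ π₂ X D sched).traj S v t).2.val = colAt π₁ π₂ X S v u := by
  simp only [gatherThen, if_pos ht, cell, hu]
  exact ⟨Nat.mod_eq_of_lt (rowAt_lt S v _), Nat.mod_eq_of_lt (colAt_lt_and_lo hS hv _).1⟩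

theorem gatherThen_notMem (hS : IsFree π₁ π₂ X S) {v : Fin m × Fin n} (hv : v ∈ S) {t : ℕ}
    (ht : t ≤ 8 * W) : (gatherThen π₁ π₂ X D sched).traj S v t ∉ X :=
  have h := gatherThen_coords (D := D) (sched := sched) hS hv ht rfl
  gather_notMem hS hv h.1 h.2

/-- Agents in the same row meet when they exchange columns, also on the way back. -/
theorem exists_meet_row (hS : IsFree π₁ π₂ X S) {v w : Fin m × Fin n} (hv : v ∈ S) (hw : w ∈ S)
    (hne : v ≠ w) (htile : SameTile π₁ π₂ w v) (hrow : w.1 = v.1) : ∃ u < W, ∀ t ≤ 8 * W,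
      min t (8 * W - t) = u →
        (gridGraph m n).Adj ((gatherThen π₁ π₂ X D sched).traj S v t)
          ((gatherThen π₁ π₂ X D sched).traj S w t) := by
  have hcol : v.2.val ≠ w.2.val := fun h => hne (Prod.ext hrow.symm (Fin.ext h))
  obtain ⟨u, hu, h⟩ := π₂.swap_meet v.2.2 w.2.2 hcol htile.2.symm
  refine ⟨u, hu, fun t ht htu => adj_of_close (Or.inl ?_)⟩
  obtain ⟨h1, h2⟩ := gatherThen_coords (D := D) (sched := sched) hS hv ht htu
  obtain ⟨h3, h4⟩ := gatherThen_coords (D := D) (sched := sched) hS hw ht htu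
  rw [h1, h2, h3, h4, rowAt_of_le S v (by omega), rowAt_of_le S w (by omega), colAt, colAt,
    if_pos (by omega), if_pos (by omega), min_eq_left (by omega), hrow]
  exact ⟨rfl, by omega⟩

theorem row_mem_know (hS : IsFree π₁ π₂ X S) {v w : Fin m × Fin n} (hv : v ∈ S) (hw : w ∈ S)
    (htile : SameTile π₁ π₂ w v) (hrow : w.1 = v.1) {t : ℕ} (ht : W ≤ t) :
    w ∈ (gatherThen π₁ π₂ X D sched).know (gridGraph m n) X S t v := by
  by_cases hne : v = w
  · subst hne
    exact Phase.self_mem_know _ _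
  · obtain ⟨u, hu, h⟩ := exists_meet_row (D := D) (sched := sched) hS hv hw hne htile hrow
    have h1 := h u (by omega) (min_eq_left (by omega))
    have h2 := Phase.know_subset_know hw (gatherThen_notMem hS hw (by omega)) h1
      (Phase.self_mem_know w u)
    exact Phase.know_mono v (show u + 1 ≤ t by omega) h2

/-- Information on `w` reaches the leader of its row by time `W`; that leader meets `v` in the free
column between times `3 * W` and `4 * W`. -/
theorem tile_mem_know_of_leads (hS : IsFree π₁ π₂ X S) {v w : Fin m × Fin n} (hv : v ∈ S)
    (hw : w ∈ S) (hvl : Leads π₁ π₂ X S v) (htile : SameTile π₁ π₂ w v) {t : ℕ} (ht : 4 * W ≤ t) :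
    w ∈ (gatherThen π₁ π₂ X D sched).know (gridGraph m n) X S t v := by
  by_cases hrow : w.1 = v.1
  · exact row_mem_know hS hv hw htile hrow (by omega)
  · obtain ⟨w', hw', htile', hrow', hwl'⟩ := exists_leads (π₁ := π₁) (π₂ := π₂) (X := X) hw
    have hne : v.1.val ≠ w'.1.val := fun h => hrow (hrow'.symm.trans (Fin.ext h.symm))
    obtain ⟨u, hu, h⟩ := π₁.swap_meet v.1.2 w'.1.2 hne (htile'.trans htile).1.symm
    have hmin : min (3 * W + u) (8 * W - (3 * W + u)) = 3 * W + u := min_eq_left (by omega)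
    obtain ⟨h1, h2⟩ := gatherThen_coords (D := D) (sched := sched) hS hv (by omega) hmin
    obtain ⟨h3, h4⟩ := gatherThen_coords (D := D) (sched := sched) hS hw' (by omega) hmin
    have hcol : ∀ {x}, x ∈ S → Leads π₁ π₂ X S x →
        colAt π₁ π₂ X S x (3 * W + u) = center π₁ π₂ X x := by
      intro x hx hxl
      rw [colAt, if_neg (by have := hu; omega), if_pos hxl, approach_center hS hx (by omega)]
    rw [rowAt, if_pos hvl, Nat.add_sub_cancel_left] at h1
    rw [rowAt, if_pos hwl', Nat.add_sub_cancel_left] at h3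
    rw [hcol hv hvl] at h2
    rw [hcol hw' hwl', center_eq (htile'.trans htile)] at h4
    have hadj : (gridGraph m n).Adj ((gatherThen π₁ π₂ X D sched).traj S v (3 * W + u))
        ((gatherThen π₁ π₂ X D sched).traj S w' (3 * W + u)) :=
      adj_of_close (Or.inr ⟨h2.trans h4.symm, by rw [h1, h3]; omega⟩)
    have h5 := Phase.know_subset_know hw' (gatherThen_notMem hS hw' (by omega)) hadj
      (row_mem_know hS hw' hw htile'.symm hrow'.symm (by omega))
    exact Phase.know_mono v (show 3 * W + u + 1 ≤ t by omega) h5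

/-- On the way back, during the last `W` steps of the backward motion or at its end, an agent meets
its leader again. The leader has known the whole tile since time `4 * W`. -/
theorem tile_mem_know (hS : IsFree π₁ π₂ X S) {v w : Fin m × Fin n} (hv : v ∈ S)
    (hw : w ∈ S) (htile : SameTile π₁ π₂ w v) {t : ℕ} (ht : 8 * W < t) :
    w ∈ (gatherThen π₁ π₂ X D sched).know (gridGraph m n) X S t v := by
  obtain ⟨v', hv', htile', hrow', hvl'⟩ := exists_leads (π₁ := π₁) (π₂ := π₂) (X := X) hv
  by_cases hne : v = v'
  · subst hne
    exact tile_mem_know_of_leads hS hv hw hvl' htile (by omega)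
  · obtain ⟨u, hu, h⟩ := exists_meet_row (D := D) (sched := sched) hS hv hv' hne htile' hrow'
    have h1 := h (8 * W - u) (by omega) (by omega)
    have h2 := Phase.know_subset_know hv' (gatherThen_notMem hS hv' (by omega)) h1
      (tile_mem_know_of_leads hS hv' hw hvl' (htile.trans htile'.symm) (by omega))
    exact Phase.know_mono v (show 8 * W - u + 1 ≤ t by omega) h2

theorem leads_congr {K : Finset (Fin m × Fin n)} (hKS : K ⊆ S) {v : Fin m × Fin n}
    (h : ∀ w ∈ S, SameTile π₁ π₂ w v → w.1 = v.1 → w ∈ K) :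
    Leads π₁ π₂ X K v ↔ Leads π₁ π₂ X S v :=
  ⟨fun hl w hw ht h1 => hl w (h w hw ht h1) ht h1, fun hl w hw ht h1 => hl w (hKS hw) ht h1⟩

/-- Knowledge always arrives before it is used: the row exchange needs none, deciding who leads
needs the agents of one's row in the tile, and the final schedule needs those of the tile. -/
theorem gatherThen_loc (hS : IsFree π₁ π₂ X S) {v : Fin m × Fin n} (hv : v ∈ S) (t : ℕ) :
    (gatherThen π₁ π₂ X D sched).traj
      ((gatherThen π₁ π₂ X D sched).know (gridGraph m n) X S (t + 1) v) v (t + 1) =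
    (gatherThen π₁ π₂ X D sched).traj S v (t + 1) := by
  have hK := Phase.know_subset (G := gridGraph m n) (X := X) (p := gatherThen π₁ π₂ X D sched) hv
    (t + 1)
  have hrow := fun w hw ht hr ht' => row_mem_know (D := D) (sched := sched) hS hv (w := w) hw ht hr
    (t := t + 1) ht'
  have htile := fun w hw ht ht' => tile_mem_know (D := D) (sched := sched) hS hv (w := w) hw ht
    (t := t + 1) ht'
  generalize (gatherThen π₁ π₂ X D sched).know (gridGraph m n) X S (t + 1) v = K at *
  simp only [gatherThen]
  split_ifs with ht
  · by_cases hW : min (t + 1) (8 * W - (t + 1)) ≤ 2 * W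
    · rw [rowAt_of_le _ _ (by omega), rowAt_of_le _ _ (by omega), colAt, colAt, if_pos hW, if_pos hW]
    · have := leads_congr (π₁ := π₁) (π₂ := π₂) (X := X) hK (v := v)
        fun w hw h1 h2 => hrow w hw h1 h2 (by omega)
      by_cases hl : Leads π₁ π₂ X S v
      · simp only [rowAt, colAt, if_pos hl, if_pos (this.mpr hl)]
      · simp only [rowAt, colAt, if_neg hl, if_neg fun h => hl (this.mp h)]
  · have : K.filter (fun w => SameTile π₁ π₂ w v) = S.filter fun w => SameTile π₁ π₂ w v := by
      ext w
      simp only [Finset.mem_filter]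
      exact ⟨fun h => ⟨hK h.1, h.2⟩, fun h => ⟨htile w h.1 h.2 (by omega), h.2⟩⟩
    rw [this]

/-- Moves within a tile. -/
def TileMove (π₁ : IntervalPartition m W) (π₂ : IntervalPartition n W) (u v : Fin m × Fin n) : Prop :=
  (v = u ∨ (gridGraph m n).Adj u v) ∧ SameTile π₁ π₂ v u

theorem gatherThen_add (hS : IsFree π₁ π₂ X S)
    (hsched : ∀ v ∈ S, IsSchedule (TileMove π₁ π₂) X (S.filter fun w => SameTile π₁ π₂ w v)
      (S.filter fun w => SameTile π₁ π₂ w v) D (sched (S.filter fun w => SameTile π₁ π₂ w v)))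
    {v : Fin m × Fin n} (hv : v ∈ S) (t : ℕ) :
    (gatherThen π₁ π₂ X D sched).traj S v (8 * W + t) =
      sched (S.filter fun w => SameTile π₁ π₂ w v) v t := by
  rcases Nat.eq_zero_or_pos t with rfl | ht
  · rw [(hsched v hv).start v (Finset.mem_filter.mpr ⟨hv, rfl, rfl⟩)]
    obtain ⟨h1, h2⟩ := gatherThen_coords (D := D) (sched := sched) hS hv (t := 8 * W) (u := 0) le_rfl
      (by omega)
    rw [rowAt_of_le _ _ (Nat.zero_le _)] at h1
    rw [colAt, if_pos (Nat.zero_le _), Nat.zero_min, π₂.swap_zero v.2.2] at h2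
    exact Prod.ext (Fin.ext h1) (Fin.ext h2)
  · simp only [gatherThen]
    rw [if_neg (by omega), Nat.add_sub_cancel_left]

theorem sameTile_sched
    (hsched : ∀ v ∈ S, IsSchedule (TileMove π₁ π₂) X (S.filter fun w => SameTile π₁ π₂ w v)
      (S.filter fun w => SameTile π₁ π₂ w v) D (sched (S.filter fun w => SameTile π₁ π₂ w v)))
    {v : Fin m × Fin n} (hv : v ∈ S) {t : ℕ} (ht : t ≤ D) :
    SameTile π₁ π₂ (sched (S.filter fun w => SameTile π₁ π₂ w v) v t) v := by
  have hv' : v ∈ S.filter fun w => SameTile π₁ π₂ w v := Finset.mem_filter.mpr ⟨hv, rfl, rfl⟩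
  induction t with
  | zero => rw [(hsched v hv).start v hv']; exact ⟨rfl, rfl⟩
  | succ t ih => exact ((hsched v hv).move v hv' t ht).2.trans (ih (by omega))

theorem gatherThen_ok (hS : IsFree π₁ π₂ X S)
    (hsched : ∀ v ∈ S, IsSchedule (TileMove π₁ π₂) X (S.filter fun w => SameTile π₁ π₂ w v)
      (S.filter fun w => SameTile π₁ π₂ w v) D (sched (S.filter fun w => SameTile π₁ π₂ w v))) :
    (gatherThen π₁ π₂ X D sched).Ok (gridGraph m n) X S where
  loc v hv t _ _ := gatherThen_loc hS hv t
  sched := by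
    have hself : ∀ v ∈ S, v ∈ S.filter fun w => SameTile π₁ π₂ w v := fun v hv =>
      Finset.mem_filter.mpr ⟨hv, rfl, rfl⟩
    have hadd := fun v hv => gatherThen_add hS hsched (v := v) hv
    have hsplit : ∀ t < 8 * W + D, t < 8 * W ∨ ∃ u < D, t = 8 * W + u := by
      intro t ht
      by_cases h : t < 8 * W
      · exact Or.inl h
      · exact Or.inr ⟨t - 8 * W, by omega, by omega⟩
    have hdur : (gatherThen π₁ π₂ X D sched).dur = 8 * W + D := rfl
    constructor
    · intro v hv
      obtain ⟨h1, h2⟩ := gatherThen_coords (D := D) (sched := sched) hS hv (t := 0) (u := 0)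
        (by omega) (by omega)
      rw [rowAt_of_le _ _ (Nat.zero_le _)] at h1
      rw [colAt, if_pos (Nat.zero_le _), Nat.zero_min, π₂.swap_zero v.2.2] at h2
      exact Prod.ext (Fin.ext h1) (Fin.ext h2)
    · intro v hv t ht
      rcases hsplit t ht with h | ⟨u, hu, rfl⟩
      · obtain ⟨h1, h2⟩ := gatherThen_coords (D := D) (sched := sched) hS hv h.le rfl
        obtain ⟨h3, h4⟩ := gatherThen_coords (D := D) (sched := sched) hS hv
          (show t + 1 ≤ 8 * W from h) rfl
        apply eq_or_adj_of_close
        rw [h1, h2, h3, h4]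
        by_cases h4 : t < 4 * W
        · have := gather_succ hS hv t
          rw [min_eq_left (by omega), min_eq_left (by omega)]
          omega
        · have := gather_succ hS hv (8 * W - (t + 1))
          rw [min_eq_right (by omega), min_eq_right (by omega),
            show 8 * W - t = 8 * W - (t + 1) + 1 by omega]
          omega
      · rw [add_assoc, hadd v hv, hadd v hv]
        exact ((hsched v hv).move v (hself v hv) u hu).1
    · intro v hv t ht hX
      rcases hsplit t ht with h | ⟨u, hu, rfl⟩
      · exact absurd hX (gatherThen_notMem hS hv h.le)
      · rw [add_assoc, hadd v hv, hadd v hv] at *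
        exact (hsched v hv).absorb v (hself v hv) u hu hX
    · intro v hv w hw hne t ht hvX hwX heq
      rcases hsplit t ht with h | ⟨u, hu, rfl⟩
      · obtain ⟨h1, h2⟩ := gatherThen_coords (D := D) (sched := sched) hS hv
          (show t + 1 ≤ 8 * W from h) rfl
        obtain ⟨h3, h4⟩ := gatherThen_coords (D := D) (sched := sched) hS hw
          (show t + 1 ≤ 8 * W from h) rfl
        rw [heq] at h1 h2
        exact hne (gather_injective hS hv hw (h1.symm.trans h3) (h2.symm.trans h4))
      · rw [add_assoc, hadd v hv, hadd w hw] at heq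
        rw [hadd v hv] at hvX
        rw [hadd w hw] at hwX
        have h1 := sameTile_sched hsched hv (show u + 1 ≤ D from hu)
        have h2 := sameTile_sched hsched hw (show u + 1 ≤ D from hu)
        -- Schedules of different tiles cannot interfere, because moves stay within a tile.
        -- Colliding agents therefore follow the same schedule.
        have htile : SameTile π₁ π₂ w v := by
          rw [heq] at h1
          exact h2.symm.trans h1
        have hfil : (S.filter fun x => SameTile π₁ π₂ x w) = S.filter fun x => SameTile π₁ π₂ x v :=
          Finset.filter_congr fun x _ => ⟨fun h => h.trans htile, fun h => h.trans htile.symm⟩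
        rw [hfil] at heq hwX
        exact (hsched v hv).coll v (hself v hv) w (Finset.mem_filter.mpr ⟨hw, htile⟩) hne u hu
          hvX hwX heq
    · intro v hv
      rw [hdur, hadd v hv]
      exact ((hsched v hv).final v (hself v hv)).imp_right fun h => (Finset.mem_filter.mp h).1

theorem mem_next_gatherThen (hS : IsFree π₁ π₂ X S)
    (hsched : ∀ v ∈ S, IsSchedule (TileMove π₁ π₂) X (S.filter fun w => SameTile π₁ π₂ w v)
      (S.filter fun w => SameTile π₁ π₂ w v) D (sched (S.filter fun w => SameTile π₁ π₂ w v)))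
    {u : Fin m × Fin n}
    (hu : u ∈ (gatherThen π₁ π₂ X D sched).next X S) : u ∉ X ∧ u ∈ S ∧ ∃ v ∈ S, SameTile π₁ π₂ u v ∧
      u = sched (S.filter fun w => SameTile π₁ π₂ w v) v D := by
  simp only [Phase.next, Finset.mem_filter, Finset.mem_image] at hu
  obtain ⟨⟨v, hv, rfl⟩, hX⟩ := hu
  have hdur : (gatherThen π₁ π₂ X D sched).dur = 8 * W + D := rfl
  rw [hdur, gatherThen_add hS hsched hv] at hX ⊢
  refine ⟨hX, ?_, v, hv, sameTile_sched hsched hv le_rfl, rfl⟩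
  have := ((hsched v hv).final v (Finset.mem_filter.mpr ⟨hv, rfl, rfl⟩)).resolve_left hX
  exact (Finset.mem_filter.mp this).1

end

/-! ### Existence of evacuation strategies -/

section existence
variable {V : Type} [DecidableEq V] {G : SimpleGraph V} {X : Finset V}

/-- In a connected graph all agents can evacuate: let the agent closest to an exit go first. -/
theorem exists_isStrategyWithTimes (hG : G.Connected) (hX : X.Nonempty) (k : ℕ) :
    ∀ H : Finset V, H.card = k → Disjoint H X → ∃ loc s, IsStrategyWithTimes G X H loc s := by
  induction k with
  | zero =>
    intro H hH _
    obtain rfl := Finset.card_eq_zero.mp hH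
    exact ⟨fun a _ => a, fun _ => 0, fun a => (Finset.notMem_empty _ a.2).elim,
      fun a => (Finset.notMem_empty _ a.2).elim, fun a => (Finset.notMem_empty _ a.2).elim,
      fun a => (Finset.notMem_empty _ a.2).elim, fun a => (Finset.notMem_empty _ a.2).elim⟩
  | succ k ih =>
    intro H hH hHX
    have hne : H.Nonempty := Finset.card_pos.mp (by omega)
    obtain ⟨⟨p, x⟩, hpx, hmin⟩ := (H ×ˢ X).exists_min_image (fun c => G.dist c.1 c.2)
      (hne.product hX)
    obtain ⟨hp, hx⟩ := Finset.mem_product.mp hpx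
    simp only at hp hx
    obtain ⟨w, hw⟩ := hG.exists_walk_length_eq_dist p x
    have hwX : ∀ t < w.length, w.getVert t ∉ X := by
      intro t ht h
      have h1 := hmin (p, w.getVert t) (Finset.mem_product.mpr ⟨hp, h⟩)
      have h2 := G.dist_le (w.take t)
      rw [SimpleGraph.Walk.take_length] at h2
      simp only at h1
      omega
    have hwH : ∀ t, 1 ≤ t → t ≤ w.length → w.getVert t ∉ H := by
      intro t ht ht' h
      have h1 := hmin (w.getVert t, x) (Finset.mem_product.mpr ⟨h, hx⟩)
      have h2 := G.dist_le (w.drop t)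
      rw [SimpleGraph.Walk.drop_length] at h2
      simp only at h1
      omega
    obtain ⟨loc, s, hs⟩ := ih (H.erase p) (by rw [Finset.card_erase_of_mem hp]; omega)
      (Finset.disjoint_of_subset_left (Finset.erase_subset _ _) hHX)
    have her : ∀ a : H, (a : V) ≠ p → (a : V) ∈ H.erase p := fun a ha =>
      Finset.mem_erase.mpr ⟨ha, a.2⟩
    refine ⟨fun a t => if h : (a : V) = p then w.getVert t else
        if t ≤ w.length then a else loc ⟨a, her a h⟩ (t - w.length),
      fun a => if h : (a : V) = p then w.length else w.length + s ⟨a, her a h⟩, ?_, ?_, ?_, ?_, ?_⟩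
    · intro a
      by_cases h : (a : V) = p
      · simp [h]
      · simp [h]
    · intro a t ht
      by_cases h : (a : V) = p
      · simp only [h, dif_pos] at ht ⊢
        exact Or.inr (w.adj_getVert_succ ht)
      · simp only [h, dif_neg, not_false_iff] at ht ⊢
        by_cases h1 : t + 1 ≤ w.length
        · rw [if_pos h1, if_pos (by omega)]
          exact Or.inl rfl
        · have h3 := hs.move ⟨a, her a h⟩ (t - w.length) (by omega)
          rw [if_neg h1, show t + 1 - w.length = t - w.length + 1 by omega]
          by_cases h2 : t ≤ w.length
          · rw [if_pos h2]
            rw [Nat.sub_eq_zero_of_le h2, hs.start] at h3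
            rw [Nat.sub_eq_zero_of_le h2]
            exact h3
          · rw [if_neg h2]
            exact h3
    · intro a
      by_cases h : (a : V) = p
      · simp only [h, dif_pos]
        rw [w.getVert_length]
        exact hx
      · simp only [h, dif_neg, not_false_iff]
        have h3 := hs.exit ⟨a, her a h⟩
        split_ifs with h1
        · rw [show s ⟨a, her a h⟩ = 0 by omega, hs.start] at h3
          exact h3
        · rw [Nat.add_sub_cancel_left]
          exact h3
    · intro a t ht
      by_cases h : (a : V) = p
      · simp only [h, dif_pos] at ht ⊢
        exact hwX t ht
      · simp only [h, dif_neg, not_false_iff] at ht ⊢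
        split_ifs with h1
        · exact Finset.disjoint_left.mp hHX a.2
        · exact hs.first ⟨a, her a h⟩ _ (by omega)
    · intro a b hab t h1 h2
      obtain ⟨h3, h4⟩ := le_min_iff.mp h2
      clear h2
      by_cases ha : (a : V) = p
      · have hb : (b : V) ≠ p := fun hb => hab (Subtype.ext (ha.trans hb.symm))
        simp only [ha, hb, dif_pos, dif_neg, not_false_iff] at h3 h4 ⊢
        rw [if_pos h3]
        exact fun h => hwH t h1 h3 (h ▸ b.2)
      · by_cases hb : (b : V) = p
        · simp only [ha, hb, dif_pos, dif_neg, not_false_iff] at h3 h4 ⊢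
          rw [if_pos h4]
          exact fun h => hwH t h1 h4 (h ▸ a.2)
        · simp only [ha, hb, dif_neg, not_false_iff] at h3 h4 ⊢
          split_ifs with h5
          · exact fun h => hab (Subtype.ext h)
          · exact hs.collision_free ⟨a, her a ha⟩ ⟨b, her b hb⟩
              (fun h => hab (Subtype.ext (Subtype.mk.inj h))) _ (by omega)
              (le_min_iff.mpr ⟨by omega, by omega⟩)

/-- The offline optimum is attained. -/
theorem exists_isStrategyOfLength_OPT (hG : G.Connected) (hX : X.Nonempty) {H : Finset V}
    (hHX : Disjoint H X) : ∃ loc, IsStrategyOfLength G X H loc (OPT G X H) := by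
  obtain ⟨loc, s, hs⟩ := exists_isStrategyWithTimes hG hX _ H rfl hHX
  exact Nat.sInf_mem (s := {ℓ : ℕ | ∃ loc : H → ℕ → V, IsStrategyOfLength G X H loc ℓ})
    ⟨_, loc, s, hs, rfl⟩

end existence

theorem gridGraph_connected {m n : ℕ} (hm : 0 < m) (hn : 0 < n) : (gridGraph m n).Connected := by
  obtain ⟨m, rfl⟩ : ∃ k, m = k + 1 := ⟨m - 1, by omega⟩
  obtain ⟨n, rfl⟩ : ∃ k, n = k + 1 := ⟨n - 1, by omega⟩
  exact (SimpleGraph.pathGraph_connected m).boxProd (SimpleGraph.pathGraph_connected n)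

/-! ### Composing parts that leave only old positions occupied -/

section stages
variable {V : Type} [DecidableEq V] {G : SimpleGraph V} {X : Finset V}

theorem oks_append (ps qs : List (Phase V)) (S : Finset V) :
    Oks G X (ps ++ qs) S ↔ Oks G X ps S ∧ Oks G X qs (nexts X ps S) := by
  induction ps generalizing S with
  | nil => simp [Oks, nexts]
  | cons p ps ih => simp only [List.cons_append, Oks, nexts, ih, and_assoc]

/-- The phases can be carried out from any set of vertices without exits, and in the end a subset of
it is occupied. -/
def Safe (G : SimpleGraph V) (X : Finset V) (ps : List (Phase V)) : Prop :=
  ∀ S, Disjoint S X → Oks G X ps S ∧ nexts X ps S ⊆ S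

theorem Safe.append {ps qs : List (Phase V)} (hp : Safe G X ps) (hq : Safe G X qs) :
    Safe G X (ps ++ qs) := by
  intro S hS
  obtain ⟨h1, h2⟩ := hp S hS
  obtain ⟨h3, h4⟩ := hq _ (Finset.disjoint_of_subset_left h2 hS)
  rw [oks_append, nexts_append]
  exact ⟨⟨h1, h3⟩, h4.trans h2⟩

theorem Safe.flatten {l : List (List (Phase V))} (h : ∀ ps ∈ l, Safe G X ps) :
    Safe G X l.flatten := by
  induction l with
  | nil => exact fun S _ => ⟨trivial, subset_rfl⟩
  | cons p l ih =>
    rw [List.flatten_cons]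
    exact (h p (by simp)).append (ih fun ps hps => h ps (by simp [hps]))

theorem total_flatten {V : Type} (l : List (List (Phase V))) :
    total l.flatten = (l.map total).sum := by
  induction l with
  | nil => rfl
  | cons p l ih => rw [List.flatten_cons, total_append, ih, List.map_cons, List.sum_cons]

/-- What is occupied after a sequence of safe parts was so after any single one of them. -/
theorem exists_of_mem_nexts_flatten {l : List (List (Phase V))} (h : ∀ ps ∈ l, Safe G X ps)
    {S : Finset V} (hS : Disjoint S X) {v : V} (hv : v ∈ nexts X l.flatten S) {ps : List (Phase V)}
    (hps : ps ∈ l) : ∃ S' ⊆ S, v ∈ nexts X ps S' := by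
  obtain ⟨l₁, l₂, rfl⟩ := List.append_of_mem hps
  rw [List.flatten_append, List.flatten_cons, nexts_append, nexts_append] at hv
  have h1 := (Safe.flatten (l := l₁) fun ps hps => h ps (by simp [hps])) S hS
  have h2 := (h ps hps) _ (Finset.disjoint_of_subset_left h1.2 hS)
  have h3 := (Safe.flatten (l := l₂) fun ps hps => h ps (by simp [hps])) _
    (Finset.disjoint_of_subset_left (h2.2.trans h1.2) hS)
  exact ⟨_, h1.2, h3.2 hv⟩

open Classical in
/-- A schedule that evacuates as many agents as there are in `Z` and leaves the others outside `Z`, if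
there is one; otherwise the agents stay. -/
noncomputable def bestSched (M : V → V → Prop) (X Z : Finset V) (D : ℕ) (S : Finset V) :
    V → ℕ → V :=
  if h : ∃ r, IsSchedule M X S (S \ Z) D r then h.choose else fun v _ => v

/-- Even when the guess is too small, the result is a legal schedule ending at exits or in `S`; this
makes every stage safe. -/
theorem bestSched_spec {M : V → V → Prop} (hM : ∀ v, M v v) {X Z S : Finset V} (D : ℕ) :
    IsSchedule M X S S D (bestSched M X Z D S) := by
  unfold bestSched
  split_ifs with h
  · obtain ⟨h1, h2, h3, h4, h5⟩ := h.choose_spec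
    exact ⟨h1, h2, h3, h4, fun v hv => (h5 v hv).imp_right fun h => (Finset.mem_sdiff.mp h).1⟩
  · exact ⟨fun _ _ => rfl, fun v _ _ _ => hM v, fun _ _ _ _ _ => rfl, fun _ _ _ _ h _ _ _ _ => h,
      fun _ hv => Or.inr hv⟩

theorem bestSched_final {M : V → V → Prop} {X Z S : Finset V} {D : ℕ}
    (h : ∃ r, IsSchedule M X S (S \ Z) D r) {v : V} (hv : v ∈ S) :
    bestSched M X Z D S v D ∈ X ∨ bestSched M X Z D S v D ∉ Z := by
  unfold bestSched
  rw [dif_pos h]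
  exact (h.choose_spec.final v hv).imp_right fun h => (Finset.mem_sdiff.mp h).2

end stages

/-! ### Stages and doubling -/

open IntervalPartition

section
variable {m n : ℕ} (X : Finset (Fin m × Fin n)) {L : ℕ} (hL : 0 < L) (s₁ s₂ : ℕ)

/-- The central blocks of the tiles, with side length `L`. -/
def centralBlocks (m n L s₁ s₂ : ℕ) : Finset (Fin m × Fin n) :=
  Finset.univ.filter fun v => (v.1.val + s₁ * L) / L % 3 = 1 ∧ (v.2.val + s₂ * L) / L % 3 = 1

/-- Evacuate the central blocks if this is possible in `L` steps. -/
noncomputable def stage : List (Phase (Fin m × Fin n)) :=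
  [(leftward (m := m) (shifted n hL s₂)).flush X, (rightward (m := m) (shifted n hL s₂)).flush X,
    (upward (n := n) (shifted m hL s₁)).flush X, (downward (n := n) (shifted m hL s₁)).flush X,
    gatherThen (shifted m hL s₁) (shifted n hL s₂) X (3 * L)
      (bestSched (TileMove (shifted m hL s₁) (shifted n hL s₂)) X (centralBlocks m n L s₁ s₂)
        (3 * L))]

theorem total_stage : total (stage X hL s₁ s₂) = 39 * L := by
  -- With `W = 3 * L`: four flushes of length `W`, gathering in `8 * W` steps, and a schedule of
  -- length `3 * L`.
  simp only [stage, total, List.map_cons, List.map_nil, List.sum_cons, List.sum_nil,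
    Direction.flush, gatherThen]
  ring

variable {X}

theorem tileMove_refl {W : ℕ} (π₁ : IntervalPartition m W) (π₂ : IntervalPartition n W)
    (v : Fin m × Fin n) : TileMove π₁ π₂ v v :=
  ⟨Or.inl rfl, rfl, rfl⟩

/-- An agent stays in the tile of its homebase as long as it is close to it. -/
theorem sameTile_of_mem_centralBlocks {u v : Fin m × Fin n} (hv : v ∈ centralBlocks m n L s₁ s₂)
    (h1 : u.1.val ≤ v.1.val + L ∧ v.1.val ≤ u.1.val + L)
    (h2 : u.2.val ≤ v.2.val + L ∧ v.2.val ≤ u.2.val + L) :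
    SameTile (shifted m hL s₁) (shifted n hL s₂) u v := by
  obtain ⟨-, hv1, hv2⟩ := Finset.mem_filter.mp hv
  exact ⟨shifted_lo_eq hL hv1 h1.2 h1.1, shifted_lo_eq hL hv2 h2.2 h2.1⟩

theorem close_of_adj {u v : Fin m × Fin n} (h : v = u ∨ (gridGraph m n).Adj u v) :
    (v.1.val ≤ u.1.val + 1 ∧ u.1.val ≤ v.1.val + 1) ∧
      (v.2.val ≤ u.2.val + 1 ∧ u.2.val ≤ v.2.val + 1) := by
  rcases h with rfl | h
  · omega
  · rw [gridGraph_adj] at h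
    rcases abs_cases ((u.1.val : ℤ) - (v.1.val : ℤ)) with h1 | h1 <;>
      rcases abs_cases ((u.2.val : ℤ) - (v.2.val : ℤ)) with h2 | h2 <;> omega

theorem IsStrategyWithTimes.close {H : Finset (Fin m × Fin n)} {loc : H → ℕ → Fin m × Fin n}
    {s : H → ℕ} (h : IsStrategyWithTimes (gridGraph m n) X H loc s) (a : H) {t : ℕ} (ht : t ≤ s a) :
    ((loc a t).1.val ≤ (a : Fin m × Fin n).1.val + t ∧
      (a : Fin m × Fin n).1.val ≤ (loc a t).1.val + t) ∧
    ((loc a t).2.val ≤ (a : Fin m × Fin n).2.val + t ∧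
      (a : Fin m × Fin n).2.val ≤ (loc a t).2.val + t) := by
  induction t with
  | zero => rw [h.start]; omega
  | succ t ih =>
    have h1 := ih (by omega)
    have h2 := close_of_adj (h.move a t ht)
    omega

/-- The given routes of the central agents take at most `L` steps and so remain in their tiles. The
remaining agents of `S` play the role of bystanders in `exists_isSchedule_union`. -/
theorem exists_isSchedule_tile {H : Finset (Fin m × Fin n)} {loc : H → ℕ → Fin m × Fin n}
    {s : H → ℕ} (h : IsStrategyWithTimes (gridGraph m n) X H loc s) (hs : ∀ a, s a ≤ L)
    {S : Finset (Fin m × Fin n)} (hSH : S ⊆ H) (hSX : Disjoint S X) :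
    ∃ r, IsSchedule (TileMove (shifted m hL s₁) (shifted n hL s₂)) X S
      (S \ centralBlocks m n L s₁ s₂) (3 * L) r := by
  have hmem : ∀ p ∈ S ∩ centralBlocks m n L s₁ s₂, p ∈ H := fun p hp =>
    hSH (Finset.mem_inter.mp hp).1
  have := exists_isSchedule_union (TileMove (shifted m hL s₁) (shifted n hL s₂))
    (tileMove_refl _ _) X (S \ centralBlocks m n L s₁ s₂) (S ∩ centralBlocks m n L s₁ s₂)
    (Finset.disjoint_sdiff_inter _ _) (by rwa [Finset.sdiff_union_inter]) hL
    (fun p t => if hp : p ∈ H then loc ⟨p, hp⟩ t else p)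
    (fun p => if hp : p ∈ H then s ⟨p, hp⟩ else 0) ?_ ?_ ?_ ?_ ?_
  · rwa [Finset.sdiff_union_inter] at this
  · intro p hp
    simp only [hmem p hp, dif_pos, h.start]
  · intro p hp
    simp only [hmem p hp, dif_pos]
    exact hs _
  · intro p hp t ht
    simp only [hmem p hp, dif_pos] at ht ⊢
    have hsp := hs ⟨p, hmem p hp⟩
    have h1 := h.close ⟨p, hmem p hp⟩ ht.le
    have h2 := h.close ⟨p, hmem p hp⟩ (show t + 1 ≤ _ from ht)
    have hc := (Finset.mem_inter.mp hp).2
    simp only at h1 h2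
    refine ⟨h.move _ t ht, SameTile.trans (v := p) ?_ (SameTile.symm ?_)⟩
    · exact sameTile_of_mem_centralBlocks hL s₁ s₂ hc (by omega) (by omega)
    · exact sameTile_of_mem_centralBlocks hL s₁ s₂ hc (by omega) (by omega)
  · intro p hp
    simp only [hmem p hp, dif_pos]
    exact h.exit _
  · intro p hp p' hp' hne t h1 h2 h3
    simp only [hmem p hp, hmem p' hp', dif_pos] at h2 h3 ⊢
    exact h.collision_free _ _ (fun h => hne (Subtype.mk.inj h)) t h1 (le_min h2 h3)

/-- A flush leaves the surviving agents where they were, so the four conditions accumulate and give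
`IsFree`. The strategy for `H` occurs only in the analysis: its existence guarantees that the search
in `bestSched` succeeds. -/
theorem stage_spec {S : Finset (Fin m × Fin n)} (hS : Disjoint S X) :
    Oks (gridGraph m n) X (stage X hL s₁ s₂) S ∧ nexts X (stage X hL s₁ s₂) S ⊆ S ∧
    ∀ (H : Finset (Fin m × Fin n)) (loc : H → ℕ → Fin m × Fin n) (s : H → ℕ), S ⊆ H →
      IsStrategyWithTimes (gridGraph m n) X H loc s → (∀ a, s a ≤ L) →
      ∀ v ∈ nexts X (stage X hL s₁ s₂) S, v ∉ centralBlocks m n L s₁ s₂ := by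
  have e1 := fun (S) v (hv : v ∈ _) =>
    (leftward (m := m) (shifted n hL s₂)).mem_next_flush (X := X) (S := S) (v := v) hv
  have e2 := fun (S) v (hv : v ∈ _) =>
    (rightward (m := m) (shifted n hL s₂)).mem_next_flush (X := X) (S := S) (v := v) hv
  have e3 := fun (S) v (hv : v ∈ _) =>
    (upward (n := n) (shifted m hL s₁)).mem_next_flush (X := X) (S := S) (v := v) hv
  have e4 := fun (S) v (hv : v ∈ _) =>
    (downward (n := n) (shifted m hL s₁)).mem_next_flush (X := X) (S := S) (v := v) hv
  simp only [stage, nexts, Oks, Direction.flush_ok, true_and, and_true]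
  generalize hS1 : ((leftward (m := m) (shifted n hL s₂)).flush X).next X S = S1
  generalize hS2 : ((rightward (m := m) (shifted n hL s₂)).flush X).next X S1 = S2
  generalize hS3 : ((upward (n := n) (shifted m hL s₁)).flush X).next X S2 = S3
  generalize hS4 : ((downward (n := n) (shifted m hL s₁)).flush X).next X S3 = S4
  have d4 : ∀ v ∈ S4, v ∈ S3 ∧ _ := fun v hv => e4 S3 v (hS4 ▸ hv)
  have d3 : ∀ v ∈ S3, v ∈ S2 ∧ _ := fun v hv => e3 S2 v (hS3 ▸ hv)
  have d2 : ∀ v ∈ S2, v ∈ S1 ∧ _ := fun v hv => e2 S1 v (hS2 ▸ hv)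
  have d1 : ∀ v ∈ S1, v ∈ S ∧ _ := fun v hv => e1 S v (hS1 ▸ hv)
  have hsub : S4 ⊆ S := fun v hv => (d1 v (d2 v (d3 v (d4 v hv).1).1).1).1
  have hX4 : Disjoint S4 X := Finset.disjoint_of_subset_left hsub hS
  have hfree : IsFree (shifted m hL s₁) (shifted n hL s₂) X S4 := by
    intro v hv x hx ht
    obtain ⟨h3, f4⟩ := d4 v hv
    obtain ⟨h2, f3⟩ := d3 v h3
    obtain ⟨h1, f2⟩ := d2 v h2
    obtain ⟨-, f1⟩ := d1 v h1
    have hne : x ≠ v := fun h => Finset.disjoint_left.mp hX4 hv (h ▸ hx)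
    constructor
    · intro h
      rcases lt_trichotomy x.2.val v.2.val with hlt | heq | hlt
      · exact f1 x hx ⟨h.symm, hlt, ht.2.symm⟩
      · exact hne (Prod.ext h (Fin.ext heq))
      · exact f2 x hx ⟨h.symm, hlt, ht.2.symm⟩
    · intro h
      rcases lt_trichotomy x.1.val v.1.val with hlt | heq | hlt
      · exact f3 x hx ⟨h.symm, hlt, ht.1.symm⟩
      · exact hne (Prod.ext (Fin.ext heq) h)
      · exact f4 x hx ⟨h.symm, hlt, ht.1.symm⟩
  have hsched : ∀ v ∈ S4, IsSchedule (TileMove (shifted m hL s₁) (shifted n hL s₂)) X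
      (S4.filter fun w => SameTile (shifted m hL s₁) (shifted n hL s₂) w v)
      (S4.filter fun w => SameTile (shifted m hL s₁) (shifted n hL s₂) w v) (3 * L)
      (bestSched (TileMove (shifted m hL s₁) (shifted n hL s₂)) X (centralBlocks m n L s₁ s₂)
        (3 * L) (S4.filter fun w => SameTile (shifted m hL s₁) (shifted n hL s₂) w v)) :=
    fun v _ => bestSched_spec (tileMove_refl _ _) _
  refine ⟨gatherThen_ok hfree hsched, fun u hu => hsub (mem_next_gatherThen hfree hsched hu).2.1, ?_⟩
  intro H loc s hSH hstrat hs u hu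
  obtain ⟨huX, -, v, hv, -, hu⟩ := mem_next_gatherThen hfree hsched hu
  have hfil := Finset.filter_subset (fun w => SameTile (shifted m hL s₁) (shifted n hL s₂) w v) S4
  have := bestSched_final (exists_isSchedule_tile hL s₁ s₂ hstrat hs
    ((hfil.trans hsub).trans hSH) (Finset.disjoint_of_subset_left hfil hX4))
    (Finset.mem_filter.mpr ⟨hv, rfl, rfl⟩ : v ∈ _)
  rw [← hu] at this
  exact this.resolve_left huX

variable (X)

/-- All the stages for a given guess `L` of the optimum. -/
noncomputable def stages : List (List (Phase (Fin m × Fin n))) :=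
  (List.range 3).flatMap fun s₁ => (List.range 3).map fun s₂ => stage X hL s₁ s₂

theorem total_stages : total (stages X hL).flatten = 351 * L := by
  rw [total_flatten]
  simp only [stages, List.range_succ, List.range_zero, List.nil_append, List.flatMap_cons,
    List.flatMap_nil, List.map_cons, List.map_nil, List.cons_append, List.append_nil,
    total_stage, List.sum_cons, List.sum_nil]
  ring

variable {X}

theorem safe_of_mem_stages {ps : List (Phase (Fin m × Fin n))} (h : ps ∈ stages X hL) :
    Safe (gridGraph m n) X ps := by
  simp only [stages, List.mem_flatMap, List.mem_map] at h
  obtain ⟨s₁, -, s₂, -, rfl⟩ := h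
  exact fun S hS => ⟨(stage_spec hL s₁ s₂ hS).1, (stage_spec hL s₁ s₂ hS).2.1⟩

-- An agent remaining at `v` at the end would also have been at `v` right after the stage whose
-- central blocks contain `v`, but that stage cleared them.
set_option maxRecDepth 4000 in
theorem nexts_stages_eq_empty {H : Finset (Fin m × Fin n)} {loc : H → ℕ → Fin m × Fin n}
    {s : H → ℕ} (h : IsStrategyWithTimes (gridGraph m n) X H loc s) (hs : ∀ a, s a ≤ L)
    (hHX : Disjoint H X) {S : Finset (Fin m × Fin n)} (hSH : S ⊆ H) :
    nexts X (stages X hL).flatten S = ∅ := by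
  refine Finset.eq_empty_of_forall_notMem fun v hv => ?_
  obtain ⟨s₁, hs₁, h1⟩ := exists_shift v.1 hL
  obtain ⟨s₂, hs₂, h2⟩ := exists_shift v.2 hL
  have hSX := Finset.disjoint_of_subset_left hSH hHX
  have hmem : stage X hL s₁ s₂ ∈ stages X hL :=
    List.mem_flatMap.mpr ⟨s₁, List.mem_range.mpr hs₁,
      List.mem_map.mpr ⟨s₂, List.mem_range.mpr hs₂, rfl⟩⟩
  have hsafe : ∀ ps ∈ stages X hL, Safe (gridGraph m n) X ps := fun ps hps =>
    safe_of_mem_stages hL hps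
  obtain ⟨S', hS', hv'⟩ := exists_of_mem_nexts_flatten hsafe hSX hv hmem
  have hc : v ∈ centralBlocks m n L s₁ s₂ := by
    rw [centralBlocks, Finset.mem_filter]
    exact ⟨Finset.mem_univ _, h1, h2⟩
  exact (stage_spec hL s₁ s₂ (Finset.disjoint_of_subset_left hS' hSX)).2.2 H loc s (hS'.trans hSH) h
    hs v hv' hc

variable (X)

/-- The phases for the guesses `1, 2, 4, …, 2 ^ (k - 1)` of the optimum. -/
noncomputable def doubling (k : ℕ) : List (Phase (Fin m × Fin n)) :=
  ((List.range k).map fun i => (stages X (Nat.two_pow_pos i)).flatten).flatten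

theorem doubling_succ (k : ℕ) :
    doubling X (k + 1) = doubling X k ++ (stages X (Nat.two_pow_pos k)).flatten := by
  simp [doubling, List.range_succ]

theorem doubling_add (k l : ℕ) : ∃ ps, doubling X (k + l) = doubling X k ++ ps := by
  induction l with
  | zero => exact ⟨[], by simp⟩
  | succ l ih =>
    obtain ⟨ps, h⟩ := ih
    exact ⟨_, by rw [← add_assoc, doubling_succ, h, List.append_assoc]⟩

/-- The geometric sum `351 * (2 ^ k - 1)`, stated without subtraction. -/
theorem total_doubling (k : ℕ) : total (doubling X k) + 351 = 351 * 2 ^ k := by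
  induction k with
  | zero => simp [doubling, total]
  | succ k ih =>
    rw [doubling_succ, total_append, total_stages, pow_succ]
    omega

theorem safe_doubling (k : ℕ) : Safe (gridGraph m n) X (doubling X k) := by
  apply Safe.flatten
  intro ps hps
  obtain ⟨i, -, rfl⟩ := List.mem_map.mp hps
  exact Safe.flatten fun ps => safe_of_mem_stages _

end
end Evacuation

theorem theorem1 :
    ∃ C : ℕ, ∀ (m n : ℕ) (X : Finset (Fin m × Fin n)), X.Nonempty →
      ∃ A : Evacuation.DistributedAlgorithm (Fin m × Fin n),
        ∀ H : Finset (Fin m × Fin n), H.Nonempty → Disjoint H X →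
          ∃ ℓ : ℕ,
            Evacuation.IsStrategyOfLength (gridGraph m n) X H (A.run (gridGraph m n) X H) ℓ ∧
              ℓ ≤ C * Evacuation.OPT (gridGraph m n) X H := by
  open Evacuation in
  -- `1404 = 4 * 351`: the first power of two that is at least the optimum `T` is at most `2 * T`,
  -- and summing over all guesses up to it costs another factor of 2.
  refine ⟨1404, fun m n X hX => ?_⟩
  obtain ⟨x, hx⟩ := hX
  have hG := gridGraph_connected (Nat.zero_lt_of_lt x.1.2) (Nat.zero_lt_of_lt x.2.2)
  -- The algorithm must not depend on `H` and has finite memory. A bound on the optimum for all `H`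
  -- limits the number of guesses.
  let K := Finset.univ.sup fun H : Finset (Fin m × Fin n) => OPT (gridGraph m n) X H
  refine ⟨algorithm (doubling X (K + 1)), fun H hH hHX => ?_⟩
  obtain ⟨loc, s, hstrat, hs⟩ := exists_isStrategyOfLength_OPT hG ⟨x, hx⟩ hHX
  -- For optimum `0` the length of the first guess could not be charged to it.
  have hpos : 0 < OPT (gridGraph m n) X H := by
    obtain ⟨a, ha⟩ := hH
    have h1 : s ⟨a, ha⟩ ≤ OPT (gridGraph m n) X H := hs ▸ Finset.le_sup (Finset.mem_univ _)
    refine lt_of_lt_of_le (Nat.pos_of_ne_zero fun h0 => ?_) h1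
    have h2 := hstrat.exit ⟨a, ha⟩
    rw [h0, hstrat.start] at h2
    exact Finset.disjoint_left.mp hHX ha h2
  have hK : OPT (gridGraph m n) X H ≤ K :=
    Finset.le_sup (f := fun H => OPT (gridGraph m n) X H) (Finset.mem_univ H)
  generalize OPT (gridGraph m n) X H = T at *
  have hT : T ≤ 2 ^ Nat.clog 2 T := Nat.le_pow_clog (by norm_num) T
  have hT' : 2 ^ Nat.clog 2 T ≤ 2 * T := by
    by_cases h1 : T = 1
    · subst h1; simp
    · have h2 := Nat.pow_pred_clog_lt_self (show 1 < 2 by norm_num) (show 1 < T by omega)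
      have h3 : Nat.clog 2 T = (Nat.clog 2 T).pred + 1 := by
        have := Nat.clog_pos (show 1 < 2 by norm_num) (show 2 ≤ T by omega)
        rw [Nat.pred_eq_sub_one]
        omega
      rw [h3, pow_succ]
      omega
  have hle : Nat.clog 2 T ≤ K :=
    (Nat.clog_le_of_le_pow (hK.trans Nat.lt_two_pow_self.le))
  obtain ⟨ps, hps⟩ := doubling_add X (Nat.clog 2 T + 1) (K - Nat.clog 2 T)
  rw [show Nat.clog 2 T + 1 + (K - Nat.clog 2 T) = K + 1 by omega] at hps
  have hempty : nexts X (doubling X (Nat.clog 2 T + 1)) H = ∅ := by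
    rw [doubling_succ, nexts_append]
    -- After the smaller guesses a subset of `H` is still occupied, so the optimal strategy for `H`
    -- certifies the decisive guess.
    refine nexts_stages_eq_empty _ hstrat (fun a => ?_) hHX (safe_doubling X _ H hHX).2
    exact (Finset.le_sup (Finset.mem_univ a)).trans (hs.le.trans hT)
  obtain ⟨ℓ, h1, h2⟩ := exists_isStrategyOfLength hHX _ ps hps (safe_doubling X _ H hHX).1 hempty
  refine ⟨ℓ, h1, h2.trans ?_⟩
  have := total_doubling X (Nat.clog 2 T + 1)
  rw [pow_succ] at this
  omega
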